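/- Theorem. Let $S$ be a semigroup with a topology for which multiplication is separately continuous, and let $X$ be a compact Hausdorff space with a separately continuous left action $S\times X\to X$ (semigroup actions are such that an identity element of $S$, if there is one, acts as the identity map). All Banach spaces are real. For a Banach space $V$ let $\Theta(V)$ be the semigroup of linear operators on $V$ of norm at most $1$, and let $B(V^*)$ be the closed unit ball of $V^*$ with the weak$^*$ topology. Call a left $S$-action on a topological space $Z$ *$S$-Eberlein* if there are a reflexive Banach space $V$, an antihomomorphism $h:S\to\Theta(V)$ that is continuous for the weak operator topology, and a topological embedding $\alpha:Z\to B(V^*)$ with $\alpha(sz)(v)=\alpha(z)(h(s)v)$ for all $s\in S$, $z\in Z$, $v\in V$. Let $S$ act from the right on $C(X)=C(X,\mathbb R)$ by $(fs)(x)=f(sx)$, from the left on $B(C(X)^*)$ by $(s\varphi)(f)=\varphi(fs)$, and from the left, by push-forward of measures, on the space $P(X)$ of regular Borel probability measures on $X$ with the weak$^*$ topology. A set $K\subset C(X)$ is $S$-invariant if $fs\in K$ for all $f\in K$, $s\in S$. The following are equivalent. 1. $X$ is $S$-Eberlein. 2. There are a Banach space $V$, a homomorphism $h:S\to\Theta(V)$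 (not assumed continuous), and a topological embedding $\alpha:X\to(V,\mathrm{weak})$ with $\alpha(sx)=h(s)\alpha(x)$ for all $s\in S$, $x\in X$. 3. There are a compact Hausdorff space $Y$ with a right action of $S$ (not assumed continuous) and a separately continuous map $\langle\cdot,\cdot\rangle:Y\times X\to\mathbb R$ with $\langle ys,x\rangle=\langle y,sx\rangle$ for all $y\in Y$, $s\in S$, $x\in X$, such that $x\mapsto\langle\cdot,x\rangle$ is a topological embedding of $X$ into $C(Y)$ with the topology of pointwise convergence. 4. There is a sequence of $S$-invariant weakly compact sets $K_n\subset C(X)$ such that $\bigcup_n K_n$ separates the points of $X$. 5. There is an $S$-invariant weakly compact set $M\subset C(X)$ whose linear span is norm dense in $C(X)$. 6. $B(C(X)^*)$ is $S$-Eberlein. 7. $P(X)$ is $S$-Eberlein. -/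

import Mathlib

open Set Topology MeasureTheory

universe u v

/-- Convention on actions: an identity element of `S`, if there is one, acts as the identity map. -/
def ActsUnitally (S : Type v) (X : Type u) [Semigroup S] [SemigroupAction S X] : Prop :=
  ∀ e : S, (∀ s : S, e * s = s ∧ s * e = s) → ∀ x : X, e • x = x

/-- A semitopological (left) `S`-flow: an action `S × X → X` that is separately continuous. -/
class SemitopologicalFlow (S : Type v) (X : Type u) [Semigroup S] [TopologicalSpace S]
    [TopologicalSpace X] [SemigroupAction S X] : Prop extends ContinuousConstSMul S X where
  continuous_orbit : ∀ x : X, Continuous fun s : S => s • x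
  acts_unitally : ActsUnitally S X

/-- A real normed space is reflexive if its canonical map into the bidual is onto. -/
def IsReflexiveSpace (V : Type u) [NormedAddCommGroup V] [NormedSpace ℝ V] : Prop :=
  Function.Surjective (NormedSpace.inclusionInDoubleDual ℝ V)

/-- The closed unit ball `B(V*)` of the dual space, with the weak-star topology. -/
abbrev DualBall (V : Type u) [NormedAddCommGroup V] [NormedSpace ℝ V] : Type u :=
  {φ : WeakDual ℝ V // ‖WeakDual.toStrongDual φ‖ ≤ 1}

/-- A `V`-representation of an `S`-flow `X`: an antihomomorphism `h` of `S` into the semigroup of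
non-expansive linear operators on `V`, continuous for the weak operator topology, and a
weak-star continuous map `α : X → B(V*)` which is equivariant for the dual left action
`(s ψ)(v) = ψ (h s v)` of `S` on `V*`. -/
structure BanachRepresentation (S : Type v) (X : Type u) [Semigroup S] [TopologicalSpace S]
    [TopologicalSpace X] [SemigroupAction S X]
    (V : Type u) [NormedAddCommGroup V] [NormedSpace ℝ V] where
  h : S → V →L[ℝ] V
  norm_le_one : ∀ s, ‖h s‖ ≤ 1
  antihom : ∀ s t, h (s * t) = (h t).comp (h s)
  weakly_continuous : Continuous fun s => (ContinuousLinearMapWOT.equiv.symm (h s) : V →WOT[ℝ] V)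
  α : X → DualBall V
  continuous_α : Continuous α
  equivariant : ∀ (s : S) (x : X) (v : V), (α (s • x)).1 v = (α x).1 (h s v)

/-- The flow `X` is `S`-Eberlein: it has a faithful representation (the map `α` is a topological
embedding) on a reflexive Banach space. -/
def IsEberleinFlow (S : Type v) (X : Type u) [Semigroup S] [TopologicalSpace S]
    [TopologicalSpace X] [SemigroupAction S X] : Prop :=
  ∃ (V : Type u) (_ : NormedAddCommGroup V) (_ : NormedSpace ℝ V) (_ : CompleteSpace V),
    IsReflexiveSpace V ∧ ∃ ρ : BanachRepresentation S X V, IsEmbedding ρ.α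

/-- There is a Banach space `V`, a homomorphism `h` from `S` to the non-expansive operators on `V`
(with no continuity assumption), and an equivariant topological embedding of `X` into `V` with
its weak topology. -/
def EmbedsInWeakBanach (S : Type v) (X : Type u) [Semigroup S]
    [TopologicalSpace X] [SemigroupAction S X] : Prop :=
  ∃ (V : Type u) (_ : NormedAddCommGroup V) (_ : NormedSpace ℝ V) (_ : CompleteSpace V)
    (h : S → V →L[ℝ] V) (α : X → V),
    (∀ s, ‖h s‖ ≤ 1) ∧ (∀ s t, h (s * t) = (h s).comp (h t)) ∧
    (∀ (s : S) (x : X), α (s • x) = h s (α x)) ∧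
    IsEmbedding fun x => toWeakSpace ℝ V (α x)

/-- A right strict `S`-duality `p : Y × X → ℝ`, where `S` acts on `Y` from the right, that is,
`y s = MulOpposite.op s • y`: a separately continuous map with `⟨y s, x⟩ = ⟨y, s x⟩` for which
`x ↦ ⟨·, x⟩` is a topological embedding for the topology of pointwise convergence on `Y`. -/
structure IsRightStrictDuality (S : Type v) {Y X : Type u} [Semigroup S]
    [TopologicalSpace Y] [TopologicalSpace X] [SemigroupAction Sᵐᵒᵖ Y] [SemigroupAction S X]
    (p : Y → X → ℝ) : Prop where
  continuous_left : ∀ x, Continuous fun y => p y x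
  continuous_right : ∀ y, Continuous fun x => p y x
  invariant : ∀ (y : Y) (s : S) (x : X), p (MulOpposite.op s • y) x = p y (s • x)
  right_strict : IsEmbedding fun (x : X) (y : Y) => p y x

/-- There is a right strict `S`-duality `Y × X → ℝ` with a compact Hausdorff space `Y`, on which
`S` acts from the right (with no continuity assumption). -/
def HasRightStrictDuality (S : Type v) (X : Type u) [Semigroup S]
    [TopologicalSpace X] [SemigroupAction S X] : Prop :=
  ∃ (Y : Type u) (_ : TopologicalSpace Y) (_ : CompactSpace Y) (_ : T2Space Y)
    (_ : SemigroupAction Sᵐᵒᵖ Y) (p : Y → X → ℝ),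
    ActsUnitally Sᵐᵒᵖ Y ∧ IsRightStrictDuality S p

/-- A subset of a normed space is weakly compact. -/
def IsWeaklyCompact {V : Type u} [NormedAddCommGroup V] [NormedSpace ℝ V] (K : Set V) : Prop :=
  IsCompact (toWeakSpace ℝ V '' K)

section Flow

variable {S : Type v} {X : Type u} [Semigroup S] [TopologicalSpace X] [SemigroupAction S X]
  [ContinuousConstSMul S X]

/-- The right action of `S` on `C(X)`: `(f s)(x) = f (s x)`. -/
def rightTranslate (f : C(X, ℝ)) (s : S) : C(X, ℝ) :=
  f.comp ⟨fun x => s • x, continuous_const_smul s⟩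

variable (S) in
/-- Invariance of a set of functions under the right action of `S` on `C(X)`. -/
def IsInvariantSet (K : Set C(X, ℝ)) : Prop :=
  ∀ f ∈ K, ∀ s : S, rightTranslate f s ∈ K

variable [CompactSpace X]

/-- The translation `f ↦ f s` as a continuous linear operator on the Banach space `C(X)`. -/
noncomputable def translateCLM (s : S) : C(X, ℝ) →L[ℝ] C(X, ℝ) :=
  LinearMap.mkContinuous
    { toFun := fun f => rightTranslate f s
      map_add' := fun _ _ => rfl
      map_smul' := fun _ _ => rfl } 1 (fun f => by
        rw [one_mul]
        exact (ContinuousMap.norm_le _ (norm_nonneg f)).2 fun x => f.norm_coe_le_norm (s • x))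

theorem norm_translateCLM_le (s : S) : ‖translateCLM (X := X) s‖ ≤ 1 :=
  LinearMap.mkContinuous_norm_le _ zero_le_one _

/-- The dual left action of `S` on `B(C(X)*)`: `(s φ)(f) = φ (f s)`. -/
noncomputable instance DualBall.semigroupAction : SemigroupAction S (DualBall C(X, ℝ)) where
  smul s φ := ⟨StrongDual.toWeakDual ((WeakDual.toStrongDual φ.1).comp (translateCLM s)), by
    refine (ContinuousLinearMap.opNorm_comp_le _ _).trans ?_
    exact mul_le_one₀ φ.2 (norm_nonneg _) (norm_translateCLM_le s)⟩
  mul_smul s t φ := by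
    refine Subtype.ext (DFunLike.ext _ _ fun f => ?_)
    change φ.1 (rightTranslate f (s * t)) = φ.1 (rightTranslate (rightTranslate f s) t)
    congr 1
    ext x
    exact congrArg f (mul_smul s t x)

theorem DualBall.smul_apply (s : S) (φ : DualBall C(X, ℝ)) (f : C(X, ℝ)) :
    (s • φ).1 f = φ.1 (rightTranslate f s) := rfl

end Flow

/-- `P(X)`: the regular Borel probability measures on `X`, with the topology of weak convergence
of measures, that is, convergence of the integrals of all bounded continuous functions. -/
abbrev RegularProbability (X : Type u) [TopologicalSpace X] [MeasurableSpace X] : Type u :=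
  {μ : ProbabilityMeasure X // (μ : Measure X).Regular}

section Probability

variable {S : Type v} {X : Type u} [Semigroup S] [TopologicalSpace X] [SemigroupAction S X]
  [ContinuousConstSMul S X] [CompactSpace X] [T2Space X] [MeasurableSpace X] [BorelSpace X]

/-- The left action of `S` on `P(X)` by push-forward: `(s μ)(A) = μ {x | s x ∈ A}`. -/
noncomputable instance RegularProbability.semigroupAction :
    SemigroupAction S (RegularProbability X) where
  smul s μ := ⟨μ.1.map (f := fun x => s • x) (continuous_const_smul s).measurable.aemeasurable, by
    have := μ.2
    have h : (Measure.map (fun x : X => s • x) (μ.1 : Measure X)).InnerRegular :=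
      Measure.InnerRegular.map_of_continuous (continuous_const_smul s)
    have : IsFiniteMeasure (Measure.map (fun x : X => s • x) (μ.1 : Measure X)) := inferInstance
    change (Measure.map (fun x : X => s • x) (μ.1 : Measure X)).Regular
    infer_instance⟩
  mul_smul s t μ := by
    refine Subtype.ext (Subtype.ext ?_)
    change Measure.map (fun x : X => (s * t) • x) (μ.1 : Measure X)
      = Measure.map (fun x : X => s • x) (Measure.map (fun x : X => t • x) (μ.1 : Measure X))
    rw [Measure.map_map (continuous_const_smul s).measurable (continuous_const_smul t).measurable]
    congr 1
    ext x
    exact mul_smul s t x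

theorem RegularProbability.coe_smul (s : S) (μ : RegularProbability X) :
    ((s • μ).1 : Measure X) = Measure.map (fun x : X => s • x) (μ.1 : Measure X) := rfl

end Probability

section PointwiseToWeak

open Filter

/-- A bounded functional on `C(X)` is controlled by a positive one on the set where it is large. -/
theorem exists_positive_functional_dominating {X : Type*} [TopologicalSpace X] [CompactSpace X]
    (ν : StrongDual ℝ C(X, ℝ)) {ε : ℝ} (hε : 0 < ε) :
    ∃ (Λ : StrongDual ℝ C(X, ℝ)) (u : ℝ), 0 < u ∧ (∀ g, 0 ≤ g → 0 ≤ Λ g) ∧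
      ∀ f, ε ≤ |ν f| → u ≤ Λ |f| := by
  set C : Set C(X, ℝ) := {g | ∃ h, ε ≤ ν h ∧ |h| ≤ g} with hC
  rcases C.eq_empty_or_nonempty with hemp | ⟨g₀, hg₀⟩
  · refine ⟨0, 1, one_pos, fun g _ => le_rfl, fun f hf => ?_⟩
    exfalso
    have key : ∀ h, ¬ ε ≤ ν h := fun h hh => by
      have : |h| ∈ C := ⟨h, hh, le_rfl⟩
      simp [hemp] at this
    rcases le_abs.1 hf with h | h
    · exact key _ h
    · exact key (-f) (by simpa using h)
  have hconv : Convex ℝ C := by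
    rintro g ⟨h, hh, hg⟩ g' ⟨h', hh', hg'⟩ a b ha hb hab
    refine ⟨a • h + b • h', ?_, ?_⟩
    · simp only [map_add, map_smul, smul_eq_mul]
      nlinarith
    · intro x
      have h1 : |h x| ≤ g x := hg x
      have h2 : |h' x| ≤ g' x := hg' x
      change |a * h x + b * h' x| ≤ a * g x + b * g' x
      calc |a * h x + b * h' x| ≤ |a * h x| + |b * h' x| := abs_add_le _ _
        _ = a * |h x| + b * |h' x| := by rw [abs_mul, abs_mul, abs_of_nonneg ha, abs_of_nonneg hb]
        _ ≤ _ := by gcongr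
  have h0 : (0 : C(X, ℝ)) ∉ closure C := by
    intro h0
    have hpos : 0 < ε / (‖ν‖ + 1) := by positivity
    obtain ⟨g, ⟨h, hh, hg⟩, hd⟩ := Metric.mem_closure_iff.1 h0 _ hpos
    rw [dist_zero_left] at hd
    have h1 : ‖h‖ ≤ ‖g‖ := (ContinuousMap.norm_le _ (norm_nonneg _)).2 fun x =>
      ((hg x).trans (le_abs_self _)).trans (g.norm_coe_le_norm x)
    have h2 : ε ≤ ‖ν‖ * ‖h‖ := (hh.trans (le_abs_self _)).trans (ν.le_opNorm h)
    have h3 : ‖ν‖ * ‖h‖ ≤ ‖ν‖ * (ε / (‖ν‖ + 1)) := by gcongr; exact h1.trans hd.le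
    have h4 : ‖ν‖ * (ε / (‖ν‖ + 1)) < ε := by
      rw [mul_div_assoc', div_lt_iff₀ (by positivity)]
      nlinarith [norm_nonneg ν]
    linarith
  obtain ⟨Λ, u, hu, hΛ⟩ := geometric_hahn_banach_point_closed hconv.closure isClosed_closure h0
  rw [map_zero] at hu
  refine ⟨Λ, u, hu, fun p hp => ?_, fun f hf => ?_⟩
  · by_contra hneg
    push Not at hneg
    obtain ⟨h, hh, hg⟩ := hg₀
    have hmem : ∀ t : ℝ, 0 ≤ t → u < Λ g₀ + t * Λ p := fun t ht => by
      have : g₀ + t • p ∈ C := ⟨h, hh, fun x => (hg x).trans (by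
        simpa using mul_nonneg ht (hp x))⟩
      simpa using hΛ _ (subset_closure this)
    have h1 := hmem 0 le_rfl
    have h2 := hmem (Λ g₀ / (-Λ p)) (div_nonneg (by linarith) (by linarith))
    have h3 : Λ g₀ / (-Λ p) * Λ p = -Λ g₀ := by
      rw [div_neg, neg_mul, div_mul_cancel₀ _ hneg.ne]
    linarith
  · refine (hΛ _ (subset_closure ?_)).le
    rcases le_abs.1 hf with h | h
    · exact ⟨f, h, le_rfl⟩
    · exact ⟨-f, by simpa using h, by simp⟩

/-- A positive functional on `C(X)` is the integral against a finite Borel measure. -/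
theorem exists_measure_of_positive_functional {X : Type*} [TopologicalSpace X] [CompactSpace X]
    [T2Space X] [MeasurableSpace X] [BorelSpace X]
    (Λ : StrongDual ℝ C(X, ℝ)) (hΛ : ∀ g, 0 ≤ g → 0 ≤ Λ g) :
    ∃ μ : Measure X, IsFiniteMeasure μ ∧ ∀ f : C(X, ℝ), ∫ x, f x ∂μ = Λ f := by
  let L : CompactlySupportedContinuousMap X ℝ →ₗ[ℝ] ℝ :=
    { toFun := fun f => Λ f.toContinuousMap
      map_add' := fun f g => Λ.map_add _ _
      map_smul' := fun c f => Λ.map_smul _ _ }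
  let P : CompactlySupportedContinuousMap X ℝ →ₚ[ℝ] ℝ :=
    PositiveLinearMap.mk₀ L fun f hf => hΛ _ fun x => hf x
  refine ⟨RealRMK.rieszMeasure P, ?_, fun f => ?_⟩
  · exact isFiniteMeasure_iff_isFiniteMeasureOnCompacts_of_compactSpace.2 inferInstance
  · exact RealRMK.integral_rieszMeasure P ⟨f, HasCompactSupport.of_compactSpace _⟩

/-- A bounded sequence in `C(X)` which converges pointwise to zero converges weakly to zero. -/
theorem tendsto_functional_of_tendsto_pointwise {X : Type*} [TopologicalSpace X] [CompactSpace X]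
    [T2Space X] (ν : StrongDual ℝ C(X, ℝ)) (f : ℕ → C(X, ℝ)) {C : ℝ} (hC : ∀ n, ‖f n‖ ≤ C)
    (h0 : ∀ x, Tendsto (fun n => f n x) atTop (𝓝 0)) {ε : ℝ} (hε : 0 < ε) :
    ∃ n, |ν (f n)| < ε := by
  by_contra! hcon
  let _ : MeasurableSpace X := borel X
  have : BorelSpace X := ⟨rfl⟩
  obtain ⟨Λ, u, hu, hpos, hdom⟩ := exists_positive_functional_dominating ν hε
  obtain ⟨μ, hμ, hint⟩ := exists_measure_of_positive_functional Λ hpos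
  have hlim : Tendsto (fun n => ∫ x, |f n| x ∂μ) atTop (𝓝 (∫ _, 0 ∂μ)) := by
    refine tendsto_integral_of_dominated_convergence (fun _ => C)
      (fun n => (|f n|).continuous.aestronglyMeasurable) (integrable_const C)
      (fun n => .of_forall fun x => ?_) (.of_forall fun x => ?_)
    · simpa using ((f n).norm_coe_le_norm x).trans (hC n)
    · simpa using (h0 x).abs
  simp only [hint, integral_zero] at hlim
  exact absurd (ge_of_tendsto' hlim fun n => hdom _ (hcon n)) (not_le.2 hu)

variable {X Y : Type*} [TopologicalSpace X] [CompactSpace X] [TopologicalSpace Y] [CompactSpace Y]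

/-- Pointwise compact sets of continuous functions on a compact space have the Fréchet–Urysohn
property. -/
theorem exists_seq_tendsto_pointwise (F : Y → C(X, ℝ)) (hF : ∀ x, Continuous fun y => F y x)
    {A : Set Y} {y₀ : Y} (hA : y₀ ∈ closure A) :
    ∃ y : ℕ → Y, (∀ n, y n ∈ A) ∧ ∀ x, Tendsto (fun n => F (y n) x) atTop (𝓝 (F y₀ x)) := by
  classical
  have hnet : ∀ (G : Finset Y) (n : ℕ), ∃ N : Finset X, ∀ x, ∃ x' ∈ N, ∀ y ∈ G,
      |F y x' - F y x| < 1 / ((n : ℝ) + 1) := by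
    intro G n
    obtain ⟨N, hN⟩ := CompactSpace.elim_nhds_subcover
      (fun x : X => {z | ∀ y ∈ G, |F y x - F y z| < 1 / ((n : ℝ) + 1)}) (fun x => by
        refine (Filter.eventually_all_finset G).2 fun y _ => ?_
        have : Continuous fun z => |F y x - F y z| := by fun_prop
        exact (isOpen_lt this continuous_const).mem_nhds (by simp; positivity))
    refine ⟨N, fun x => ?_⟩
    have : x ∈ (⊤ : Set X) := trivial
    rw [← hN] at this
    simpa using this
  choose net hnet using hnet
  have hpick : ∀ (N : Finset X) (n : ℕ), ∃ y ∈ A, ∀ x ∈ N,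
      |F y x - F y₀ x| < 1 / ((n : ℝ) + 1) := by
    intro N n
    have hev : ∀ᶠ y in 𝓝 y₀, ∀ x ∈ N, |F y x - F y₀ x| < 1 / ((n : ℝ) + 1) := by
      refine (Filter.eventually_all_finset N).2 fun x _ => ?_
      have : Continuous fun y => |F y x - F y₀ x| := ((hF x).sub continuous_const).abs
      exact (isOpen_lt this continuous_const).mem_nhds (by simp; positivity)
    obtain ⟨y, h1, h2⟩ := ((mem_closure_iff_frequently.1 hA).and_eventually hev).exists
    exact ⟨y, h1, h2⟩
  choose pick hpickA hpick using hpick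
  let st : ℕ → Finset Y × Finset X := fun n => Nat.rec ({y₀}, ∅)
    (fun n p => (insert (pick (p.2 ∪ net p.1 n) n) p.1, p.2 ∪ net p.1 n)) n
  have st_succ : ∀ n, st (n + 1) = (insert (pick ((st n).2 ∪ net (st n).1 n) n) (st n).1,
    (st n).2 ∪ net (st n).1 n) := fun n => rfl
  have mono1 : Monotone fun n => (st n).1 := monotone_nat_of_le_succ fun n => by
    rw [st_succ]; exact Finset.subset_insert _ _
  have mono2 : Monotone fun n => (st n).2 := monotone_nat_of_le_succ fun n => by
    rw [st_succ]; exact Finset.subset_union_left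
  let y : ℕ → Y := fun n => pick (st (n + 1)).2 n
  have hyG : ∀ n, y n ∈ (st (n + 1)).1 := fun n => by
    change pick (st (n + 1)).2 n ∈ _
    rw [st_succ]; exact Finset.mem_insert_self _ _
  have hy₀G : ∀ n, y₀ ∈ (st n).1 := fun n => mono1 (Nat.zero_le n) (Finset.mem_singleton_self y₀)
  have hnetN : ∀ n m, n ≤ m → net (st n).1 n ⊆ (st (m + 1)).2 := fun n m hnm =>
    Finset.Subset.trans (s₂ := (st (n + 1)).2) (by rw [st_succ]; exact Finset.subset_union_right)
      (mono2 (Nat.succ_le_succ hnm))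
  refine ⟨y, fun n => hpickA _ _, fun x => ?_⟩
  rw [tendsto_iff_ultrafilter]
  intro U hU
  choose z hz hzx using fun n => hnet (st n).1 n x
  obtain ⟨y', -, hy'⟩ := isCompact_univ.ultrafilter_le_nhds' (U.map y) Filter.univ_mem
  obtain ⟨x', -, hx'⟩ := isCompact_univ.ultrafilter_le_nhds' (U.map z) Filter.univ_mem
  have hyt : ∀ x, Tendsto (fun n => F (y n) x) U (𝓝 (F y' x)) := fun x =>
    ((hF x).tendsto y').comp hy'
  have hxt : ∀ w, Tendsto (fun n => F w (z n)) U (𝓝 (F w x')) := fun w =>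
    ((F w).continuous.tendsto x').comp hx'
  have hrate := tendsto_one_div_add_atTop_nhds_zero_nat (𝕜 := ℝ)
  have e1 : ∀ n, F y' (z n) = F y₀ (z n) := fun n => by
    refine tendsto_nhds_unique (hyt (z n)) (Tendsto.mono_left ?_ hU)
    rw [tendsto_iff_dist_tendsto_zero]
    refine squeeze_zero' (.of_forall fun _ => dist_nonneg) ?_ hrate
    filter_upwards [eventually_ge_atTop n] with m hm
    exact (hpick _ m _ (hnetN n m hm (hz n))).le
  have e2 : ∀ w k, w ∈ (st k).1 → F w x' = F w x := fun w k hw => by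
    refine tendsto_nhds_unique (hxt w) (Tendsto.mono_left ?_ hU)
    rw [tendsto_iff_dist_tendsto_zero]
    refine squeeze_zero' (.of_forall fun _ => dist_nonneg) ?_ hrate
    filter_upwards [eventually_ge_atTop k] with m hm
    exact (hzx m w (mono1 hm hw)).le
  have e3 : F y' x' = F y' x := tendsto_nhds_unique (hyt x') (by
    simpa only [fun n => e2 (y n) (n + 1) (hyG n)] using hyt x)
  have e4 : F y' x' = F y₀ x' := tendsto_nhds_unique (hxt y') (by simpa only [e1] using hxt y₀)
  have e5 : F y' x = F y₀ x := by rw [← e3, e4, e2 y₀ 0 (hy₀G 0)]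
  rw [← e5]
  exact hyt x

/-- Grothendieck: a bounded pointwise continuous map from a compact space to `C(X)` is weakly
continuous. -/
theorem continuous_functional_of_continuous_pointwise [T2Space X] (F : Y → C(X, ℝ))
    (hF : ∀ x, Continuous fun y => F y x) {C : ℝ} (hC : ∀ y, ‖F y‖ ≤ C)
    (ν : StrongDual ℝ C(X, ℝ)) : Continuous fun y => ν (F y) := by
  refine continuous_iff_continuousAt.2 fun y₀ => ?_
  by_contra hcon
  rw [ContinuousAt, Metric.tendsto_nhds] at hcon
  push Not at hcon
  obtain ⟨ε, hε, hfr⟩ := hcon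
  obtain ⟨y, hyA, hy⟩ := exists_seq_tendsto_pointwise F hF 
    (A := {y | ε ≤ dist (ν (F y)) (ν (F y₀))}) (mem_closure_iff_frequently.2 hfr)
  obtain ⟨n, hn⟩ := tendsto_functional_of_tendsto_pointwise ν (fun n => F (y n) - F y₀)
    (C := C + C) (fun n => (norm_sub_le _ _).trans (add_le_add (hC _) (hC _)))
    (fun x => by simpa using (hy x).sub_const (F y₀ x)) hε
  have : ε ≤ dist (ν (F (y n))) (ν (F y₀)) := hyA n
  rw [Real.dist_eq, ← map_sub] at this
  linarith

end PointwiseToWeak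

section WeakTopology

open Filter

theorem continuous_toWeakSpace {Z V : Type*} [TopologicalSpace Z] [NormedAddCommGroup V]
    [NormedSpace ℝ V] {g : Z → V} (h : ∀ φ : StrongDual ℝ V, Continuous fun z => φ (g z)) :
    Continuous fun z => toWeakSpace ℝ V (g z) :=
  WeakBilin.continuous_of_continuous_eval _ h

theorem continuous_functional_weakSpace {V : Type*} [NormedAddCommGroup V]
    [NormedSpace ℝ V] (φ : StrongDual ℝ V) :
    Continuous fun v : WeakSpace ℝ V => φ ((toWeakSpace ℝ V).symm v) :=
  WeakBilin.eval_continuous (topDualPairing ℝ V).flip φ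

theorem tendsto_toWeakSpace {ι V : Type*} [NormedAddCommGroup V] [NormedSpace ℝ V] {l : Filter ι}
    {g : ι → V} {v : V} (h : ∀ φ : StrongDual ℝ V, Tendsto (fun i => φ (g i)) l (𝓝 (φ v))) :
    Tendsto (fun i => toWeakSpace ℝ V (g i)) l (𝓝 (toWeakSpace ℝ V v)) := by
  refine (WeakBilin.tendsto_iff_forall_eval_tendsto (B := (topDualPairing ℝ V).flip)
    fun x y hxy => ?_).2 h
  by_contra hne
  obtain ⟨f, hf⟩ := SeparatingDual.exists_separating_of_ne (R := ℝ) hne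
  exact hf (DFunLike.congr_fun hxy f)

/-- Weakly compact sets are bounded. -/
theorem IsWeaklyCompact.exists_norm_le {V : Type u} [NormedAddCommGroup V] [NormedSpace ℝ V]
    {K : Set V} (hK : IsWeaklyCompact K) : ∃ C, ∀ f ∈ K, ‖f‖ ≤ C := by
  obtain ⟨C, hC⟩ := banach_steinhaus (𝕜 := ℝ) (𝕜₂ := ℝ) (σ₁₂ := RingHom.id ℝ)
    (g := fun f : K => NormedSpace.inclusionInDoubleDual ℝ V f) (fun φ => by
      obtain ⟨C, hC⟩ := (hK.image (continuous_functional_weakSpace φ)).isBounded.exists_norm_le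
      exact ⟨C, fun f => hC _ ⟨toWeakSpace ℝ V f, ⟨f, f.2, rfl⟩, rfl⟩⟩)
  exact ⟨C, fun f hf => ((NormedSpace.inclusionInDoubleDualLi ℝ).norm_map f).symm.trans_le
    (hC ⟨f, hf⟩)⟩

theorem IsWeaklyCompact.of_isClosed {V : Type u} [NormedAddCommGroup V] [NormedSpace ℝ V]
    {K L : Set V} (hK : IsWeaklyCompact K) (hL : Convex ℝ L) (hLc : IsClosed L) (hLK : L ⊆ K) :
    IsWeaklyCompact L := by
  refine IsCompact.of_isClosed_subset hK ?_ (image_mono hLK)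
  rw [← hLc.closure_eq, hL.toWeakSpace_closure (𝕜 := ℝ)]
  exact isClosed_closure

theorem IsWeaklyCompact.isClosed {V : Type u} [NormedAddCommGroup V] [NormedSpace ℝ V]
    {K : Set V} (hK : IsWeaklyCompact K) : IsClosed K := by
  have h : IsClosed (toWeakSpace ℝ V '' K) := IsCompact.isClosed hK
  have := h.preimage (toWeakSpaceCLM ℝ V).continuous
  rwa [show (toWeakSpaceCLM ℝ V : V → WeakSpace ℝ V) = toWeakSpace ℝ V from rfl,
    preimage_image_eq _ (toWeakSpace ℝ V).injective] at this

instance DualBall.compactSpace {V : Type u} [NormedAddCommGroup V] [NormedSpace ℝ V] :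
    CompactSpace (DualBall V) := by
  refine isCompact_iff_compactSpace.1 ?_
  have h : {φ : WeakDual ℝ V | ‖WeakDual.toStrongDual φ‖ ≤ 1} =
      WeakDual.toStrongDual ⁻¹' Metric.closedBall 0 1 := by
    ext φ
    exact mem_closedBall_zero_iff.symm
  have h' : IsCompact {φ : WeakDual ℝ V | ‖WeakDual.toStrongDual φ‖ ≤ 1} :=
    h ▸ WeakDual.isCompact_closedBall (0 : StrongDual ℝ V) 1
  exact h'

end WeakTopology

section ContinuousFunctions

open Filter
open scoped Pointwise

variable {X : Type u} [TopologicalSpace X]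

/-- A set of continuous functions which is compact for the topology of pointwise convergence. -/
def IsPointwiseCompact (K : Set C(X, ℝ)) : Prop :=
  IsCompact ((fun f : C(X, ℝ) => (f : X → ℝ)) '' K)

theorem IsPointwiseCompact.mul {K L : Set C(X, ℝ)} (hK : IsPointwiseCompact K)
    (hL : IsPointwiseCompact L) : IsPointwiseCompact (K * L) := by
  have := IsCompact.mul hK hL
  rwa [IsPointwiseCompact,
    show (fun f : C(X, ℝ) => (f : X → ℝ)) = ContinuousMap.coeFnMonoidHom from rfl, image_mul]

theorem IsPointwiseCompact.comp {K : Set C(X, ℝ)} (hK : IsPointwiseCompact K) (g : C(ℝ, ℝ)) :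
    IsPointwiseCompact ((fun f => g.comp f) '' K) := by
  have := IsCompact.image hK (f := fun h : X → ℝ => fun x => g (h x)) (by fun_prop)
  rw [image_image] at this
  rwa [IsPointwiseCompact, image_image]

variable [CompactSpace X]

theorem continuous_coe_weakSpace :
    Continuous fun f : WeakSpace ℝ C(X, ℝ) => (((toWeakSpace ℝ _).symm f : C(X, ℝ)) : X → ℝ) :=
  continuous_pi fun x => continuous_functional_weakSpace (ContinuousMap.evalCLM ℝ x)

theorem IsWeaklyCompact.isPointwiseCompact {K : Set C(X, ℝ)} (hK : IsWeaklyCompact K) :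
    IsPointwiseCompact K := by
  have := IsCompact.image hK continuous_coe_weakSpace
  rwa [image_image] at this

theorem isWeaklyCompact_range [T2Space X] {Y : Type*} [TopologicalSpace Y] [CompactSpace Y]
    {F : Y → C(X, ℝ)} (hF : ∀ x, Continuous fun y => F y x) {C : ℝ} (hC : ∀ y, ‖F y‖ ≤ C) :
    IsWeaklyCompact (range F) := by
  rw [IsWeaklyCompact, ← range_comp]
  exact isCompact_range (continuous_toWeakSpace fun φ =>
    continuous_functional_of_continuous_pointwise F hF hC φ)

theorem IsPointwiseCompact.isWeaklyCompact [T2Space X] {K : Set C(X, ℝ)}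
    (hK : IsPointwiseCompact K) {C : ℝ} (hC : ∀ f ∈ K, ‖f‖ ≤ C) : IsWeaklyCompact K := by
  have := isCompact_iff_compactSpace.1 hK
  choose F hFK hF using fun y : (fun f : C(X, ℝ) => (f : X → ℝ)) '' K => y.2
  have hr : range F = K := by
    refine Subset.antisymm (range_subset_iff.2 hFK) fun f hf => ⟨⟨f, f, hf, rfl⟩, ?_⟩
    exact DFunLike.coe_injective (hF _)
  rw [← hr]
  refine isWeaklyCompact_range (fun x => ?_) fun y => hC _ (hFK y)
  have : (fun y => F y x) = fun y => y.1 x := funext fun y => congrFun (hF y) x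
  rw [this]
  exact (continuous_apply x).comp continuous_subtype_val

theorem isCompact_insert_iUnion {Z : Type*} [TopologicalSpace Z] {a : Z} {K : ℕ → Set Z}
    (hK : ∀ n, IsCompact (K n)) (ha : ∀ U ∈ 𝓝 a, ∀ᶠ n in atTop, K n ⊆ U) :
    IsCompact (insert a (⋃ n, K n)) := by
  refine isCompact_iff_ultrafilter_le_nhds'.2 fun U hU => ?_
  by_cases h : ∃ n, K n ∈ U
  · obtain ⟨n, hn⟩ := h
    obtain ⟨z, hz, hUz⟩ := (hK n).ultrafilter_le_nhds' U hn
    exact ⟨z, mem_insert_of_mem _ (mem_iUnion_of_mem n hz), hUz⟩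
  · push Not at h
    refine ⟨a, mem_insert _ _, fun V hV => ?_⟩
    obtain ⟨N, hN⟩ := eventually_atTop.1 (ha V hV)
    have h1 : (⋂ n ∈ Finset.range N, (K n)ᶜ) ∈ U :=
      (Filter.biInter_finset_mem _).2 fun n _ => Ultrafilter.compl_mem_iff_notMem.2 (h n)
    filter_upwards [h1, hU] with z hz1 hz2
    rcases hz2 with rfl | hz2
    · exact mem_of_mem_nhds hV
    · obtain ⟨n, hn⟩ := mem_iUnion.1 hz2
      by_cases hnN : n < N
      · exact absurd hn (mem_iInter₂.1 hz1 n (Finset.mem_range.2 hnN))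
      · exact hN n (not_lt.1 hnN) hn

/-- The union of a null sequence of multiples of uniformly bounded pointwise compact sets. -/
theorem IsPointwiseCompact.insert_zero_iUnion {K : ℕ → Set C(X, ℝ)}
    (hK : ∀ n, IsPointwiseCompact (K n)) {C : ℝ} (hC : ∀ n, ∀ f ∈ K n, ‖f‖ ≤ C) :
    IsPointwiseCompact (insert 0 (⋃ n, ((1 / 2 : ℝ) ^ n) • K n)) := by
  rw [IsPointwiseCompact, image_insert_eq, image_iUnion]
  refine isCompact_insert_iUnion (fun n => ?_) fun U hU => ?_
  · have := (hK n).smul ((1 / 2 : ℝ) ^ n)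
    rw [← image_smul, image_image] at this
    rwa [← image_smul, image_image]
  · have hcoe : Continuous fun f : C(X, ℝ) => (f : X → ℝ) := by fun_prop
    obtain ⟨ε, hε, hball⟩ := Metric.mem_nhds_iff.1 (hcoe.continuousAt.preimage_mem_nhds hU)
    have hlim : Tendsto (fun n : ℕ => (1 / 2 : ℝ) ^ n * C) atTop (𝓝 (0 * C)) :=
      (tendsto_pow_atTop_nhds_zero_of_lt_one (by norm_num) (by norm_num)).mul_const C
    rw [zero_mul] at hlim
    filter_upwards [hlim.eventually_lt_const hε] with n hn
    rintro _ ⟨_, ⟨f, hf, rfl⟩, rfl⟩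
    refine hball ?_
    rw [mem_ball_zero_iff, norm_smul, Real.norm_of_nonneg (by positivity)]
    exact (mul_le_mul_of_nonneg_left (hC n f hf) (by positivity)).trans_lt hn

variable [T2Space X]

/-- The barycentre map: integration of a bounded pointwise continuous family `F : Y → C(X)` against
functionals on `C(Y)`. -/
noncomputable def barycentre {Y : Type*} [TopologicalSpace Y] [CompactSpace Y] [T2Space Y]
    (F : Y → C(X, ℝ)) (hF : ∀ x, Continuous fun y => F y x) {C : ℝ} (hC : ∀ y, ‖F y‖ ≤ C) :
    StrongDual ℝ C(Y, ℝ) →ₗ[ℝ] C(X, ℝ) where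
  toFun μ := ⟨fun x => μ ⟨fun y => F y x, hF x⟩,
    continuous_functional_of_continuous_pointwise (fun x => (⟨fun y => F y x, hF x⟩ : C(Y, ℝ)))
      (fun y => (F y).continuous) (C := |C|)
      (fun x => (ContinuousMap.norm_le _ (abs_nonneg C)).2 fun y =>
        ((F y).norm_coe_le_norm x).trans ((hC y).trans (le_abs_self C))) μ⟩
  map_add' _ _ := rfl
  map_smul' _ _ := rfl

/-- Krein's theorem in `C(X)`. -/
theorem IsWeaklyCompact.closedAbsConvexHull {K : Set C(X, ℝ)} (hK : IsWeaklyCompact K) :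
    IsWeaklyCompact (closedAbsConvexHull ℝ K) := by
  obtain ⟨C, hC⟩ := hK.exists_norm_le
  have := isCompact_iff_compactSpace.1 hK
  let Y := toWeakSpace ℝ C(X, ℝ) '' K
  let F : Y → C(X, ℝ) := fun y => (toWeakSpace ℝ C(X, ℝ)).symm y.1
  have hFK : ∀ y, F y ∈ K := by
    rintro ⟨_, f, hf, rfl⟩
    exact hf
  have hF : ∀ x, Continuous fun y => F y x := fun x =>
    (continuous_functional_weakSpace (ContinuousMap.evalCLM ℝ x)).comp continuous_subtype_val
  have hFC : ∀ y, ‖F y‖ ≤ C := fun y => hC _ (hFK y)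
  let R := barycentre F hF hFC
  have hRC : ∀ μ : DualBall C(Y, ℝ), ‖R (WeakDual.toStrongDual μ.1)‖ ≤ |C| := fun μ => by
    refine (ContinuousMap.norm_le _ (abs_nonneg C)).2 fun x => ?_
    refine ((WeakDual.toStrongDual μ.1).le_opNorm _).trans ?_
    refine (mul_le_of_le_one_left (norm_nonneg _) μ.2).trans ?_
    exact (ContinuousMap.norm_le _ (abs_nonneg C)).2 fun y =>
        ((F y).norm_coe_le_norm x).trans ((hFC y).trans (le_abs_self C))
  have hW := isWeaklyCompact_range (F := fun μ : DualBall C(Y, ℝ) => R (WeakDual.toStrongDual μ.1))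
    (fun x => (WeakDual.eval_continuous _).comp continuous_subtype_val) hRC
  have hr : range (fun μ : DualBall C(Y, ℝ) => R (WeakDual.toStrongDual μ.1)) =
      R '' Metric.closedBall 0 1 := by
    ext f
    constructor
    · rintro ⟨μ, rfl⟩
      exact ⟨_, mem_closedBall_zero_iff.2 μ.2, rfl⟩
    · rintro ⟨μ, hμ, rfl⟩
      exact ⟨⟨StrongDual.toWeakDual μ, mem_closedBall_zero_iff.1 hμ⟩, rfl⟩
  refine hW.of_isClosed (absConvex_convexClosedHull).2 isClosed_closedAbsConvexHull ?_
  refine closedAbsConvexHull_min ?_ ?_ hW.isClosed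
  · intro f hf
    refine ⟨⟨StrongDual.toWeakDual (ContinuousMap.evalCLM ℝ
      (⟨toWeakSpace ℝ _ f, f, hf, rfl⟩ : Y)), ?_⟩, rfl⟩
    refine ContinuousLinearMap.opNorm_le_bound _ zero_le_one fun g => ?_
    rw [one_mul]
    exact g.norm_coe_le_norm _
  · rw [hr]
    refine ⟨?_, (convex_closedBall (0 : StrongDual ℝ C(Y, ℝ)) 1).linear_image R⟩
    rintro a ha _ ⟨_, ⟨μ, hμ, rfl⟩, rfl⟩
    exact ⟨a • μ, balanced_closedBall_zero a ha ⟨μ, hμ, rfl⟩, map_smul _ _ _⟩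

end ContinuousFunctions

section Reflexive

open Filter NormedSpace

/-- Weak-star continuous functionals are evaluations. -/
theorem WeakDual.exists_eq_eval {V : Type*} [NormedAddCommGroup V] [NormedSpace ℝ V]
    (f : StrongDual ℝ (WeakDual ℝ V)) : ∃ v : V, ∀ φ, f φ = φ v := by
  obtain ⟨v, hv⟩ := LinearMap.dualEmbedding_surjective (topDualPairing ℝ V) f
  exact ⟨v, fun φ => (DFunLike.congr_fun hv φ).symm⟩

/-- Goldstine's theorem. -/
theorem toWeakDual_mem_closure_image_closedBall {V : Type*} [NormedAddCommGroup V]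
    [NormedSpace ℝ V] {Φ : StrongDual ℝ (StrongDual ℝ V)} (hΦ : ‖Φ‖ ≤ 1) :
    StrongDual.toWeakDual Φ ∈ closure
      ((fun v : V => StrongDual.toWeakDual (inclusionInDoubleDual ℝ V v)) ''
        Metric.closedBall 0 1) := by
  by_contra hcon
  have hconv : Convex ℝ ((fun v : V => StrongDual.toWeakDual (inclusionInDoubleDual ℝ V v)) ''
      Metric.closedBall 0 1) :=
    (convex_closedBall (0 : V) 1).linear_image
      (StrongDual.toWeakDual.toLinearMap ∘ₗ (inclusionInDoubleDual ℝ V).toLinearMap)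
  have : LocallyConvexSpace ℝ (WeakDual ℝ (StrongDual ℝ V)) :=
    (WeakDual.withSeminorms ℝ _).toLocallyConvexSpace
  obtain ⟨f, u, hf, hu⟩ := geometric_hahn_banach_closed_point hconv.closure isClosed_closure hcon
  obtain ⟨φ, hφ⟩ := WeakDual.exists_eq_eval f
  simp only [hφ] at hu
  have hball : ∀ v : V, ‖v‖ ≤ 1 → φ v < u := fun v hv => by
    have := hf _ (subset_closure ⟨v, mem_closedBall_zero_iff.2 hv, rfl⟩)
    rwa [hφ] at this
  have h1 : u < Φ φ := hu
  have h0 : 0 < u := by simpa using hball 0 (by simp)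
  have h2 : ‖φ‖ ≤ u := ContinuousLinearMap.opNorm_le_of_unit_norm h0.le fun v hv =>
    abs_le.2 ⟨by have := hball (-v) (by simp [hv]); simp at this; linarith, (hball v hv.le).le⟩
  have h3 : Φ φ ≤ ‖φ‖ := (le_abs_self _).trans (Φ.le_of_opNorm_le hΦ φ |>.trans (one_mul _).le)
  linarith

/-- A normed space is reflexive if it maps to another one in such a way that the image of the unit
ball is weakly compact and the adjoint has dense range. -/
theorem isReflexiveSpace_of_weaklyCompact_image {V E : Type u} [NormedAddCommGroup V]
    [NormedSpace ℝ V] [NormedAddCommGroup E] [NormedSpace ℝ E] (j : V →L[ℝ] E)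
    (hj : DenseRange fun ψ : StrongDual ℝ E => (ψ.comp j : StrongDual ℝ V))
    (hK : IsWeaklyCompact (j '' Metric.closedBall 0 1)) : IsReflexiveSpace V := by
  have key : ∀ Φ : StrongDual ℝ (StrongDual ℝ V), ‖Φ‖ ≤ 1 →
      ∃ v, inclusionInDoubleDual ℝ V v = Φ := by
    intro Φ hΦ
    have hcl := toWeakDual_mem_closure_image_closedBall hΦ
    rw [mem_closure_iff_clusterPt, ← map_principal] at hcl
    obtain ⟨U, hU, hlim⟩ := mapClusterPt_iff_ultrafilter.1 hcl
    have hlim' : ∀ φ : StrongDual ℝ V, Tendsto (fun v => φ v) U (𝓝 (Φ φ)) := fun φ =>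
      ((WeakDual.eval_continuous φ).tendsto _).comp hlim
    obtain ⟨_, ⟨_, ⟨v, -, rfl⟩, rfl⟩, hv⟩ :=
      hK.ultrafilter_le_nhds' (U.map fun v => toWeakSpace ℝ E (j v)) (by
        change _ ∈ U
        filter_upwards [le_principal_iff.1 hU] with v hv using ⟨_, ⟨v, hv, rfl⟩, rfl⟩)
    refine ⟨v, ?_⟩
    have := hj.equalizer (inclusionInDoubleDual ℝ V v).continuous Φ.continuous (by
      ext ψ
      exact tendsto_nhds_unique (((continuous_functional_weakSpace ψ).tendsto _).comp hv)
        (hlim' (ψ.comp j)))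
    exact DFunLike.coe_injective this
  suffices h : ∀ Φ : StrongDual ℝ (StrongDual ℝ V), ∃ v, inclusionInDoubleDual ℝ V v = Φ from h
  intro Φ
  have hpos : 0 < ‖Φ‖ + 1 := by positivity
  obtain ⟨v, hv⟩ := key ((‖Φ‖ + 1)⁻¹ • Φ) (by
    refine ContinuousLinearMap.opNorm_le_bound _ zero_le_one fun φ => ?_
    rw [smul_apply, norm_smul, norm_inv, Real.norm_of_nonneg hpos.le, one_mul,
      inv_mul_le_iff₀ hpos]
    exact (Φ.le_opNorm φ).trans (by gcongr; linarith))
  exact ⟨(‖Φ‖ + 1) • v, by rw [map_smul, hv, smul_smul, mul_inv_cancel₀ hpos.ne', one_smul]⟩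

/-- Grothendieck: a convex closed set which can be approximated by weakly compact sets is weakly
compact. -/
theorem isWeaklyCompact_of_approx {E : Type u} [NormedAddCommGroup E] [NormedSpace ℝ E]
    [CompleteSpace E] {L : Set E} (hL : Convex ℝ L) (hLc : IsClosed L)
    (h : ∀ ε : ℝ, 0 < ε → ∃ W, IsWeaklyCompact W ∧ ∀ f ∈ L, ∃ w ∈ W, ‖f - w‖ ≤ ε) :
    IsWeaklyCompact L := by
  have hclosed : IsClosed (toWeakSpace ℝ E '' L) := by
    rw [← hLc.closure_eq, hL.toWeakSpace_closure (𝕜 := ℝ)]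
    exact isClosed_closure
  refine isCompact_iff_ultrafilter_le_nhds'.2 fun U hU => ?_
  obtain ⟨ε, -, hε, hεlim⟩ := exists_seq_strictAnti_tendsto (0 : ℝ)
  choose W hW hWL using fun n => h (ε n) (hε n)
  choose! w hwW hw using hWL
  let r : WeakSpace ℝ E → E := fun v => (toWeakSpace ℝ E).symm v
  have hrL : ∀ᶠ v in U, r v ∈ L := by
    filter_upwards [hU]
    rintro _ ⟨f, hf, rfl⟩
    exact hf
  have hex : ∀ n, ∃ ω : E, ∀ φ : StrongDual ℝ E,
      Tendsto (fun v => φ (w n (r v))) U (𝓝 (φ ω)) := by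
    intro n
    obtain ⟨_, ⟨ω, -, rfl⟩, hω⟩ := (hW n).ultrafilter_le_nhds'
      (U.map fun v => toWeakSpace ℝ E (w n (r v))) (by
        change _ ∈ U
        filter_upwards [hrL] with v hv using ⟨_, hwW n _ hv, rfl⟩)
    exact ⟨ω, fun φ => ((continuous_functional_weakSpace φ).tendsto _).comp hω⟩
  choose ω hω using hex
  have hdist : ∀ n m, ‖ω n - ω m‖ ≤ ε n + ε m := by
    intro n m
    refine norm_le_dual_bound ℝ _ (add_nonneg (hε n).le (hε m).le) fun φ => ?_
    rw [map_sub]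
    refine le_of_tendsto ((hω n φ).sub (hω m φ)).norm ?_
    filter_upwards [hrL] with v hv
    rw [← map_sub, mul_comm]
    refine (φ.le_opNorm _).trans (mul_le_mul_of_nonneg_left ?_ (norm_nonneg _))
    calc ‖w n (r v) - w m (r v)‖ = ‖(r v - w m (r v)) - (r v - w n (r v))‖ := by congr 1; abel
      _ ≤ ‖r v - w m (r v)‖ + ‖r v - w n (r v)‖ := norm_sub_le _ _
      _ ≤ ε n + ε m := by linarith [hw n _ hv, hw m _ hv]
  have hcau : CauchySeq ω := by
    refine Metric.cauchySeq_iff'.2 fun δ hδ => ?_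
    obtain ⟨N, hN⟩ := eventually_atTop.1 (hεlim.eventually_lt_const (half_pos hδ))
    refine ⟨N, fun n hn => ?_⟩
    rw [dist_eq_norm]
    linarith [hdist n N, hN n hn, hN N le_rfl]
  obtain ⟨ω', hω'⟩ := cauchySeq_tendsto_of_complete hcau
  have hdist' : ∀ n, ‖ω n - ω'‖ ≤ ε n := by
    intro n
    have h1 : Tendsto (fun m => ‖ω n - ω m‖) atTop (𝓝 ‖ω n - ω'‖) := (hω'.const_sub _).norm
    have h2 : Tendsto (fun m => ε n + ε m) atTop (𝓝 (ε n + 0)) := hεlim.const_add _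
    simpa using le_of_tendsto_of_tendsto' h1 h2 (hdist n)
  have hlim : ∀ φ : StrongDual ℝ E, Tendsto (fun v => φ (r v)) U (𝓝 (φ ω')) := by
    intro φ
    rw [Metric.tendsto_nhds]
    intro δ hδ
    have h0 : Tendsto (fun n => 2 * ‖φ‖ * ε n) atTop (𝓝 (2 * ‖φ‖ * 0)) := hεlim.const_mul _
    rw [mul_zero] at h0
    obtain ⟨n, hn⟩ := (h0.eventually_lt_const (half_pos hδ)).exists
    filter_upwards [hrL, Metric.tendsto_nhds.1 (hω n φ) (δ / 2) (half_pos hδ)] with v hv hv'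
    rw [Real.dist_eq] at hv' ⊢
    have h1 : |φ (r v - w n (r v))| ≤ ‖φ‖ * ε n :=
      (φ.le_opNorm _).trans (mul_le_mul_of_nonneg_left (hw n _ hv) (norm_nonneg _))
    have h2 : |φ (ω n - ω')| ≤ ‖φ‖ * ε n :=
      (φ.le_opNorm _).trans (mul_le_mul_of_nonneg_left (hdist' n) (norm_nonneg _))
    rw [map_sub] at h1 h2
    rw [abs_lt] at hv' ⊢
    rw [abs_le] at h1 h2
    constructor <;> linarith
  have hconv : Tendsto (fun v => toWeakSpace ℝ E (r v)) U (𝓝 (toWeakSpace ℝ E ω')) :=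
    tendsto_toWeakSpace hlim
  exact ⟨toWeakSpace ℝ E ω', hclosed.mem_of_tendsto hconv hU, hconv⟩

/-- On bounded sets of a reflexive space, weak continuity can be tested on a separating set of
functionals. -/
theorem IsReflexiveSpace.continuous_functional {V Z ι : Type*} [NormedAddCommGroup V]
    [NormedSpace ℝ V] [TopologicalSpace Z] (hV : IsReflexiveSpace V) {g : Z → V} {C : ℝ}
    (hC : ∀ z, ‖g z‖ ≤ C) (D : ι → StrongDual ℝ V) (hD : ∀ v w, (∀ i, D i v = D i w) → v = w)
    (hg : ∀ i, Continuous fun z => D i (g z)) (φ : StrongDual ℝ V) :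
    Continuous fun z => φ (g z) := by
  refine continuous_iff_continuousAt.2 fun z => ?_
  rw [ContinuousAt, tendsto_iff_ultrafilter]
  intro U hU
  obtain ⟨Φ, -, hΦ⟩ := (WeakDual.isCompact_closedBall (𝕜 := ℝ)
      (0 : StrongDual ℝ (StrongDual ℝ V)) C).ultrafilter_le_nhds'
    (U.map fun z => StrongDual.toWeakDual (inclusionInDoubleDual ℝ V (g z)))
    (by
      refine Ultrafilter.mem_map.2 (Filter.univ_mem' fun z => ?_)
      simpa using (double_dual_bound ℝ V (g z)).trans (hC z))
  obtain ⟨v, hv⟩ := hV (WeakDual.toStrongDual Φ)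
  have hlim : ∀ ψ : StrongDual ℝ V, Tendsto (fun z => ψ (g z)) U (𝓝 (ψ v)) := fun ψ => by
    have h1 : ψ v = Φ ψ := DFunLike.congr_fun hv ψ
    rw [h1]
    exact ((WeakDual.eval_continuous ψ).tendsto _).comp hΦ
  have : v = g z := hD _ _ fun i =>
    tendsto_nhds_unique (hlim (D i)) (((hg i).tendsto z).mono_left hU)
  exact this ▸ hlim φ

end Reflexive

section Renorming

variable {E : Type u} [NormedAddCommGroup E] [NormedSpace ℝ E]

/-- A norm on `E` which is equivalent to the given one. -/
structure EquivalentNorm (E : Type u) [NormedAddCommGroup E] [NormedSpace ℝ E] extends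
    Seminorm ℝ E where
  exists_le : ∃ c : ℝ, ∀ x, toSeminorm x ≤ c * ‖x‖
  exists_ge : ∃ c : ℝ, ∀ x, ‖x‖ ≤ c * toSeminorm x

/-- The space `E` with an equivalent norm. -/
def Renormed (_ : EquivalentNorm E) : Type u := E

namespace Renormed

variable (N : EquivalentNorm E)

instance : AddCommGroup (Renormed N) := inferInstanceAs (AddCommGroup E)

instance : Module ℝ (Renormed N) := inferInstanceAs (Module ℝ E)

noncomputable instance : NormedAddCommGroup (Renormed N) :=
  AddGroupNorm.toNormedAddCommGroup
    { toFun := fun x => N.toSeminorm (show E from x)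
      map_zero' := map_zero N.toSeminorm
      add_le' := map_add_le_add N.toSeminorm
      neg' := map_neg_eq_map N.toSeminorm
      eq_zero_of_map_eq_zero' := fun x hx => by
        obtain ⟨c, hc⟩ := N.exists_ge
        have h := hc x
        rw [hx, mul_zero] at h
        exact norm_le_zero_iff.1 h }

noncomputable instance : NormedSpace ℝ (Renormed N) where
  norm_smul_le a x := (map_smul_eq_mul N.toSeminorm a (show E from x)).le

/-- The identity map from `E` to `E` with an equivalent norm. -/
noncomputable def equiv : E ≃L[ℝ] Renormed N :=
  let e : E ≃ₗ[ℝ] Renormed N := LinearEquiv.refl ℝ E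
  { e with
    continuous_toFun := by
      obtain ⟨c, hc⟩ := N.exists_le
      exact (e.toLinearMap.mkContinuous c hc).continuous
    continuous_invFun := by
      obtain ⟨c, hc⟩ := N.exists_ge
      exact (e.symm.toLinearMap.mkContinuous c hc).continuous }

theorem norm_equiv (x : E) : ‖equiv N x‖ = N.toSeminorm x := rfl

instance [CompleteSpace E] : CompleteSpace (Renormed N) :=
  (completeSpace_congr (e := (equiv N).toEquiv) (equiv N).isUniformEmbedding).1 inferInstance

end Renormed

/-- The space of those `f : E` for which the sequence of equivalent norms of `f` is square summable,
as the diagonal of an `ℓ²`-sum. -/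
noncomputable def diagonalSubspace (N : ℕ → EquivalentNorm E) :
    Submodule ℝ (lp (fun n => Renormed (N n)) 2) where
  carrier := {x | ∀ n, (Renormed.equiv (N n)).symm (x n) = (Renormed.equiv (N 0)).symm (x 0)}
  add_mem' hx hy n := by
    simp only [lp.coeFn_add, Pi.add_apply, map_add, hx n, hy n]
  zero_mem' n := by simp
  smul_mem' a x hx n := by
    simp only [lp.coeFn_smul, Pi.smul_apply, map_smul, hx n]

namespace diagonalSubspace

variable (N : ℕ → EquivalentNorm E)

instance [CompleteSpace E] : CompleteSpace (diagonalSubspace N) := by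
  have hc : ∀ n, Continuous fun x : lp (fun n => Renormed (N n)) 2 =>
      (Renormed.equiv (N n)).symm (x n) := fun n =>
    (Renormed.equiv (N n)).symm.continuous.comp
      (lp.evalCLM ℝ (fun n => Renormed (N n)) 2 n).continuous
  have : IsClosed (diagonalSubspace N : Set (lp (fun n => Renormed (N n)) 2)) := by
    have h : (diagonalSubspace N : Set (lp (fun n => Renormed (N n)) 2)) =
        ⋂ n, {x | (Renormed.equiv (N n)).symm (x n) = (Renormed.equiv (N 0)).symm (x 0)} := by
      ext x
      simp [diagonalSubspace]
    rw [h]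
    exact isClosed_iInter fun n => isClosed_eq (hc n) (hc 0)
  exact this.completeSpace_coe

/-- The inclusion of the diagonal subspace into `E`. -/
noncomputable def incl : diagonalSubspace N →L[ℝ] E :=
  ((Renormed.equiv (N 0)).symm : Renormed (N 0) →L[ℝ] E).comp
    ((lp.evalCLM ℝ (fun n => Renormed (N n)) 2 0).comp (diagonalSubspace N).subtypeL)

theorem coe_apply (v : diagonalSubspace N) (n : ℕ) :
    (v : lp (fun n => Renormed (N n)) 2) n = Renormed.equiv (N n) (incl N v) := by
  rw [← ContinuousLinearEquiv.symm_apply_eq]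
  exact v.2 n

theorem incl_injective : Function.Injective (incl N) := fun v w h => by
  refine Subtype.ext (lp.ext (funext fun n => ?_))
  rw [coe_apply, coe_apply, h]

theorem norm_apply (v : diagonalSubspace N) (n : ℕ) :
    ‖(v : lp (fun n => Renormed (N n)) 2) n‖ = (N n).toSeminorm (incl N v) := by
  rw [coe_apply, Renormed.norm_equiv]

theorem exists_incl_eq_iff {f : E} {C : ℝ} (hC : 0 ≤ C) :
    (∃ v, incl N v = f ∧ ‖v‖ ≤ C) ↔ ∀ s : Finset ℕ, ∑ n ∈ s, (N n).toSeminorm f ^ 2 ≤ C ^ 2 := by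
  constructor
  · rintro ⟨v, rfl, hv⟩ s
    have h := lp.sum_rpow_le_norm_rpow (p := 2) (by norm_num)
      (v : lp (fun n => Renormed (N n)) 2) s
    simp only [ENNReal.toReal_ofNat, Real.rpow_ofNat, norm_apply] at h
    exact h.trans (pow_le_pow_left₀ (norm_nonneg v) hv 2)
  · intro h
    have h' : ∀ s : Finset ℕ, ∑ n ∈ s, ‖Renormed.equiv (N n) f‖ ^ (2 : ENNReal).toReal ≤
        C ^ (2 : ENNReal).toReal := fun s => by
      simpa [Renormed.norm_equiv] using h s
    let x : lp (fun n => Renormed (N n)) 2 := ⟨fun n => Renormed.equiv (N n) f, memℓp_gen' h'⟩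
    have hx : ∀ n, x n = Renormed.equiv (N n) f := fun _ => rfl
    refine ⟨⟨x, fun n => ?_⟩, ?_, ?_⟩
    · rw [hx, hx, ContinuousLinearEquiv.symm_apply_apply, ContinuousLinearEquiv.symm_apply_apply]
    · exact ContinuousLinearEquiv.symm_apply_apply _ _
    · exact lp.norm_le_of_forall_sum_le (by norm_num) hC h'

theorem incl_image_closedBall :
    incl N '' Metric.closedBall 0 1 = {f | ∀ s : Finset ℕ, ∑ n ∈ s, (N n).toSeminorm f ^ 2 ≤ 1} := by
  ext f
  have := exists_incl_eq_iff N (f := f) zero_le_one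
  rw [one_pow] at this
  rw [mem_ofPred_eq, ← this]
  simp [and_comm]

theorem isClosed_incl_image_closedBall : IsClosed (incl N '' Metric.closedBall 0 1) := by
  rw [incl_image_closedBall]
  have hc : ∀ n, Continuous fun f : E => (N n).toSeminorm f := fun n =>
    (Renormed.equiv (N n)).continuous.norm
  simp only [ofPred_forall]
  exact isClosed_iInter fun s => isClosed_le
    (continuous_finsetSum _ fun n _ => (hc n).pow 2) continuous_const

/-- Operators which are contractive for all the equivalent norms act on the diagonal subspace. -/
theorem exists_lift (A : E →L[ℝ] E) (hA : ∀ n f, (N n).toSeminorm (A f) ≤ (N n).toSeminorm f) :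
    ∃ B : diagonalSubspace N →L[ℝ] diagonalSubspace N,
      ‖B‖ ≤ 1 ∧ ∀ v, incl N (B v) = A (incl N v) := by
  have hex : ∀ v, ∃ w, incl N w = A (incl N v) ∧ ‖w‖ ≤ ‖v‖ := fun v => by
    refine (exists_incl_eq_iff N (norm_nonneg v)).2 fun s => ?_
    refine le_trans ?_ ((exists_incl_eq_iff N (norm_nonneg v)).1 ⟨v, rfl, le_rfl⟩ s)
    exact Finset.sum_le_sum fun n _ => pow_le_pow_left₀ (apply_nonneg _ _) (hA n _) 2
  choose B hB hBn using hex
  let L : diagonalSubspace N →ₗ[ℝ] diagonalSubspace N :=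
    { toFun := B
      map_add' := fun v w => incl_injective N (by simp only [hB, map_add])
      map_smul' := fun a v => incl_injective N (by simp only [hB, map_smul, RingHom.id_apply]) }
  exact ⟨L.mkContinuous 1 fun v => (hBn v).trans (one_mul _).ge,
    L.mkContinuous_norm_le zero_le_one _, hB⟩

end diagonalSubspace

theorem lp.sum_single_apply {ι : Type*} [DecidableEq ι] {G : ι → Type*}
    [∀ i, NormedAddCommGroup (G i)] (f : ∀ i, G i) {s : Finset ι} {i : ι} (hi : i ∈ s) :
    (∑ k ∈ s, lp.single 2 k (f k) : lp G 2) i = f i := by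
  simp only [lp.coeFn_sum, lp.coeFn_single, Finset.sum_apply, Finset.sum_pi_single, if_pos hi]

/-- Functionals on an `ℓ²`-sum have small tails. -/
theorem lp.exists_finset_functional_le {ι : Type*} {G : ι → Type*} [∀ i, NormedAddCommGroup (G i)]
    [∀ i, NormedSpace ℝ (G i)] (ψ : StrongDual ℝ (lp G 2)) {ε : ℝ} (hε : 0 < ε) :
    ∃ s : Finset ι, ∀ z : lp G 2, (∀ i ∈ s, z i = 0) → |ψ z| ≤ ε * ‖z‖ := by
  classical
  have hp : 0 < (2 : ENNReal).toReal := by norm_num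
  rcases le_or_gt ‖ψ‖ ε with hψ | hψ
  · exact ⟨∅, fun z _ => ψ.le_of_opNorm_le hψ z⟩
  have hr : √(‖ψ‖ ^ 2 - ε ^ 2) < ‖ψ‖ := by
    rw [Real.sqrt_lt' (hε.trans hψ)]
    nlinarith
  obtain ⟨a, ha, har⟩ := ContinuousLinearMap.exists_lt_apply_of_lt_opNorm ψ hr
  have hlim : Filter.Tendsto (fun s : Finset ι => ∑ i ∈ s, lp.single 2 i (a i)) Filter.atTop (𝓝 a) :=
    lp.hasSum_single (by norm_num) a
  obtain ⟨s, hs1, hs2⟩ := ((hlim.norm.eventually_lt_const ha).and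
    (((ψ.continuous.tendsto a).comp hlim).norm.eventually_const_lt har)).exists
  refine ⟨s, fun z hz => ?_⟩
  set b : lp G 2 := ∑ i ∈ s, lp.single 2 i (a i) with hb
  replace hs2 : √(‖ψ‖ ^ 2 - ε ^ 2) < |ψ b| := hs2
  have hortho : ∀ x y : ℝ, ‖x • b + y • z‖ ^ 2 = x ^ 2 * ‖b‖ ^ 2 + y ^ 2 * ‖z‖ ^ 2 := by
    intro x y
    have h1 := lp.norm_compl_sum_single hp (x • b + y • z) s
    have h2 : ∀ i ∈ s, (x • b + y • z) i = x • a i := fun i hi => by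
      change x • b i + y • z i = x • a i
      rw [hz i hi, smul_zero, add_zero, hb, lp.sum_single_apply _ hi]
    have h3 : ∑ i ∈ s, lp.single 2 i ((x • b + y • z) i) = x • b := by
      rw [Finset.sum_congr rfl fun i hi => by rw [h2 i hi, lp.single_smul], hb, Finset.smul_sum]
    have h4 := lp.norm_sum_single hp (⇑(x • b + y • z)) s
    rw [h3] at h1 h4
    rw [← h4, add_sub_cancel_left] at h1
    simp only [ENNReal.toReal_ofNat, Real.rpow_ofNat, norm_smul, mul_pow, Real.norm_eq_abs,
      sq_abs] at h1
    linarith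
  rcases eq_or_ne z 0 with rfl | hz0
  · simp
  have hzpos : 0 < ‖z‖ := norm_pos_iff.2 hz0
  set A := ψ b
  set t := ψ z / ‖z‖ ^ 2 with ht
  have htz : t * ‖z‖ ^ 2 = ψ z := by rw [ht]; field_simp
  have hQ : ψ (A • b + t • z) = A ^ 2 + t ^ 2 * ‖z‖ ^ 2 := by
    rw [map_add, map_smul, map_smul, smul_eq_mul, smul_eq_mul, ← htz]
    ring
  have hnorm : ‖A • b + t • z‖ ^ 2 ≤ A ^ 2 + t ^ 2 * ‖z‖ ^ 2 := by
    rw [hortho]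
    have : ‖b‖ ^ 2 ≤ 1 := by nlinarith [norm_nonneg b]
    nlinarith [sq_nonneg A]
  have hle : A ^ 2 + t ^ 2 * ‖z‖ ^ 2 ≤ ‖ψ‖ * ‖A • b + t • z‖ :=
    hQ ▸ (le_abs_self _).trans (ψ.le_opNorm _)
  have hA : ‖ψ‖ ^ 2 - ε ^ 2 < A ^ 2 := by
    rw [← sq_abs A]
    exact (Real.sqrt_lt_sqrt_iff_of_pos (by nlinarith [Real.sqrt_nonneg (‖ψ‖ ^ 2 - ε ^ 2)])).1
      (by rwa [Real.sqrt_sq (abs_nonneg _)])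
  have hQM : A ^ 2 + t ^ 2 * ‖z‖ ^ 2 ≤ ‖ψ‖ ^ 2 := by
    set Q := A ^ 2 + t ^ 2 * ‖z‖ ^ 2
    have hQ0 : 0 ≤ Q := by positivity
    have h1 : Q ^ 2 ≤ ‖ψ‖ ^ 2 * Q := by
      calc Q ^ 2 ≤ (‖ψ‖ * ‖A • b + t • z‖) ^ 2 := pow_le_pow_left₀ hQ0 hle 2
        _ = ‖ψ‖ ^ 2 * ‖A • b + t • z‖ ^ 2 := mul_pow _ _ _
        _ ≤ ‖ψ‖ ^ 2 * Q := by gcongr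
    rcases hQ0.eq_or_lt with h | h
    · rw [← h]; positivity
    · nlinarith
  have hfin : (t * ‖z‖) ^ 2 ≤ ε ^ 2 := by rw [mul_pow]; linarith
  have := abs_le_of_sq_le_sq hfin hε.le
  calc |ψ z| = |t * ‖z‖| * ‖z‖ := by
        rw [← htz, abs_mul, abs_mul, abs_of_pos hzpos, abs_of_pos (pow_pos hzpos 2)]; ring
    _ ≤ ε * ‖z‖ := by gcongr

theorem diagonalSubspace.denseRange_comp_incl (N : ℕ → EquivalentNorm E) :
    DenseRange fun ψ : StrongDual ℝ E =>
      (ψ.comp (incl N) : StrongDual ℝ (diagonalSubspace N)) := by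
  refine (Metric.denseRange_iff (α := StrongDual ℝ (diagonalSubspace N))).2 fun φ ε hε => ?_
  obtain ⟨ψ, hψ, -⟩ := exists_extension_norm_eq (𝕜 := ℝ) (diagonalSubspace N) φ
  obtain ⟨s, hs⟩ := lp.exists_finset_functional_le ψ (half_pos hε)
  let θ : StrongDual ℝ E := ∑ n ∈ s, ψ.comp
    ((lp.singleContinuousLinearMap ℝ (fun n => Renormed (N n)) 2 n).comp
      (Renormed.equiv (N n) : E →L[ℝ] Renormed (N n)))
  refine ⟨θ, ?_⟩
  refine (dist_eq_norm φ _).trans_lt ?_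
  refine lt_of_le_of_lt (ContinuousLinearMap.opNorm_le_bound _ (half_pos hε).le fun v => ?_)
    (half_lt_self hε)
  set w : lp (fun n => Renormed (N n)) 2 := v.1 with hw
  set z := w - ∑ n ∈ s, lp.single 2 n (w n) with hz
  have h1 : (φ - θ.comp (incl N)) v = ψ z := by
    have : θ (incl N v) = ∑ n ∈ s, ψ (lp.single 2 n (w n)) := by
      simp [θ, hw, coe_apply]
    rw [sub_apply, ContinuousLinearMap.comp_apply, this, ← hψ, hz, map_sub,
      map_sum]
  have h2 : ‖z‖ ≤ ‖v‖ := by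
    have := lp.norm_compl_sum_single (p := 2) (by norm_num) w s
    simp only [ENNReal.toReal_ofNat, Real.rpow_ofNat] at this
    refine le_of_sq_le_sq ?_ (norm_nonneg v)
    rw [this]
    exact sub_le_self _ (Finset.sum_nonneg fun n _ => sq_nonneg _)
  rw [h1]
  refine (hs z fun n hn => ?_).trans (mul_le_mul_of_nonneg_left h2 (half_pos hε).le)
  change w n - (∑ n ∈ s, lp.single 2 n (w n) : lp (fun n => Renormed (N n)) 2) n = 0
  rw [lp.sum_single_apply _ hn, sub_self]

open scoped Pointwise

/-- The neighbourhood of an absolutely convex set whose gauges define the interpolation norms of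
Davis, Figiel, Johnson and Pełczyński. -/
def interpolationSet (W : Set E) (n : ℕ) : Set E :=
  (2 : ℝ) ^ n • W + Metric.closedBall 0 ((1 / 2) ^ n)

theorem absConvex_interpolationSet {W : Set E} (hW : AbsConvex ℝ W) (n : ℕ) :
    AbsConvex ℝ (interpolationSet W n) :=
  ⟨(hW.1.smul _).add balanced_closedBall_zero, (hW.2.smul _).add (convex_closedBall _ _)⟩

theorem closedBall_subset_interpolationSet {W : Set E} (h0 : (0 : E) ∈ W) (n : ℕ) :
    Metric.closedBall 0 ((1 / 2) ^ n) ⊆ interpolationSet W n := fun x hx =>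
  ⟨0, ⟨0, h0, smul_zero _⟩, x, hx, zero_add x⟩

theorem absorbent_interpolationSet {W : Set E} (h0 : (0 : E) ∈ W) (n : ℕ) :
    Absorbent ℝ (interpolationSet W n) :=
  absorbent_nhds_zero (Filter.mem_of_superset (Metric.closedBall_mem_nhds _ (by positivity))
    (closedBall_subset_interpolationSet h0 n))

/-- The interpolation norms of Davis, Figiel, Johnson and Pełczyński. -/
noncomputable def interpolationNorm {W : Set E} (hW : AbsConvex ℝ W) (h0 : (0 : E) ∈ W)
    (hb : ∃ C, ∀ w ∈ W, ‖w‖ ≤ C) (n : ℕ) : EquivalentNorm E where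
  toSeminorm := gaugeSeminorm (absConvex_interpolationSet hW n).1 (absConvex_interpolationSet hW n).2
    (absorbent_interpolationSet h0 n)
  exists_le := by
    refine ⟨2 ^ n, fun x => ?_⟩
    have := mul_gauge_le_norm (x := x)
      (Metric.ball_subset_closedBall.trans (closedBall_subset_interpolationSet h0 n))
    change gauge _ x ≤ _
    calc gauge (interpolationSet W n) x
        = 2 ^ n * ((1 / 2) ^ n * gauge (interpolationSet W n) x) := by
          rw [← mul_assoc, ← mul_pow]; norm_num
      _ ≤ 2 ^ n * ‖x‖ := by gcongr
  exists_ge := by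
    obtain ⟨C, hC⟩ := hb
    have hC0 : 0 ≤ C := (norm_nonneg _).trans (hC 0 h0)
    refine ⟨2 ^ n * C + (1 / 2) ^ n, fun x => ?_⟩
    have hpos : 0 < 2 ^ n * C + (1 / 2) ^ n := by positivity
    have hsub : interpolationSet W n ⊆ Metric.closedBall 0 (2 ^ n * C + (1 / 2) ^ n) := by
      rintro _ ⟨_, ⟨w, hw, rfl⟩, b, hb, rfl⟩
      rw [mem_closedBall_zero_iff] at hb ⊢
      refine (norm_add_le _ _).trans (add_le_add ?_ hb)
      rw [norm_smul, Real.norm_of_nonneg (by positivity)]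
      gcongr
      exact hC w hw
    have := le_gauge_of_subset_closedBall (absorbent_interpolationSet h0 n) hpos.le hsub (x := x)
    rwa [div_le_iff₀' hpos] at this

theorem gauge_interpolationSet_map_le {W : Set E} (h0 : (0 : E) ∈ W) {A : E →L[ℝ] E}
    (hA : ‖A‖ ≤ 1) (hAW : MapsTo A W W) (n : ℕ) (f : E) :
    gauge (interpolationSet W n) (A f) ≤ gauge (interpolationSet W n) f := by
  have hmap : ∀ x ∈ interpolationSet W n, A x ∈ interpolationSet W n := by
    rintro _ ⟨_, ⟨w, hw, rfl⟩, b, hb, rfl⟩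
    refine ⟨(2 : ℝ) ^ n • A w, ⟨A w, hAW hw, rfl⟩, A b, ?_, by simp⟩
    rw [mem_closedBall_zero_iff] at hb ⊢
    exact (A.le_of_opNorm_le hA b).trans ((one_mul _).trans_le hb)
  refine le_of_forall_gt fun c hc => ?_
  obtain ⟨b, hb0, hbc, x, hx, rfl⟩ := exists_lt_of_gauge_lt (absorbent_interpolationSet h0 n) hc
  refine (gauge_le_of_mem hb0.le ?_).trans_lt hbc
  exact ⟨A x, hmap x hx, (map_smul A b x).symm⟩

/-- **Davis–Figiel–Johnson–Pełczyński**: an absolutely convex weakly compact set is contained in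
the range of an injective operator from a reflexive space, which is compatible with the contractions
leaving the set invariant. -/
theorem exists_reflexive_factorization [CompleteSpace E] {W : Set E} (hWc : IsWeaklyCompact W)
    (hW : AbsConvex ℝ W) (h0 : (0 : E) ∈ W) :
    ∃ (V : Type u) (_ : NormedAddCommGroup V) (_ : NormedSpace ℝ V) (_ : CompleteSpace V)
      (j : V →L[ℝ] E), IsReflexiveSpace V ∧ Function.Injective j ∧ W ⊆ range j ∧
      ∀ A : E →L[ℝ] E, ‖A‖ ≤ 1 → MapsTo A W W →
        ∃ B : V →L[ℝ] V, ‖B‖ ≤ 1 ∧ ∀ v, j (B v) = A (j v) := by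
  let N := interpolationNorm hW h0 hWc.exists_norm_le
  refine ⟨diagonalSubspace N, inferInstance, inferInstance, inferInstance,
    diagonalSubspace.incl N, ?_, diagonalSubspace.incl_injective N, fun w hw => ?_,
    fun A hA hAW => diagonalSubspace.exists_lift N A fun n f =>
      gauge_interpolationSet_map_le h0 hA hAW n f⟩
  · refine isReflexiveSpace_of_weaklyCompact_image _ (diagonalSubspace.denseRange_comp_incl N) ?_
    refine isWeaklyCompact_of_approx ((convex_closedBall (0 : diagonalSubspace N) 1).linear_image
      (diagonalSubspace.incl N).toLinearMap)
      (diagonalSubspace.isClosed_incl_image_closedBall N) fun ε hε => ?_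
    obtain ⟨n, hn⟩ := exists_pow_lt_of_lt_one (half_pos hε) (show (1 / 2 : ℝ) < 1 by norm_num)
    refine ⟨((2 : ℝ) ^ (n + 1)) • W, ?_, fun f hf => ?_⟩
    · have := IsCompact.smul ((2 : ℝ) ^ (n + 1)) hWc
      rwa [IsWeaklyCompact, image_smul_set]
    · rw [diagonalSubspace.incl_image_closedBall] at hf
      have h1 : gauge (interpolationSet W n) f ≤ 1 := by
        have := hf {n}
        rw [Finset.sum_singleton, sq_le_one_iff₀ (apply_nonneg _ _)] at this
        exact this
      obtain ⟨b, hb0, hb2, x, ⟨_, ⟨w, hw, rfl⟩, c, hc, rfl⟩, rfl⟩ :=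
        exists_lt_of_gauge_lt (absorbent_interpolationSet h0 n) (h1.trans_lt one_lt_two)
      rw [mem_closedBall_zero_iff] at hc
      refine ⟨b • (2 : ℝ) ^ n • w, ⟨(b / 2) • w, hW.1 (b / 2) ?_ ⟨w, hw, rfl⟩, ?_⟩, ?_⟩
      · rw [Real.norm_of_nonneg (by positivity)]
        linarith
      · change (2 : ℝ) ^ (n + 1) • (b / 2) • w = _
        rw [smul_smul, smul_smul]
        congr 1
        ring
      · change ‖b • ((2 : ℝ) ^ n • w + c) - b • (2 : ℝ) ^ n • w‖ ≤ ε
        rw [smul_add, add_sub_cancel_left, norm_smul, Real.norm_of_nonneg hb0.le]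
        nlinarith [norm_nonneg c]
  · obtain ⟨v, hv, -⟩ := (diagonalSubspace.exists_incl_eq_iff N (f := w) zero_le_two).2 fun s => by
      have h1 : ∀ n, (N n).toSeminorm w ^ 2 ≤ (1 / 4 : ℝ) ^ n := fun n => by
        have h2 : gauge (interpolationSet W n) w ≤ (1 / 2) ^ n := by
          refine gauge_le_of_mem (by positivity) ⟨(2 : ℝ) ^ n • w, ⟨_, ⟨w, hw, rfl⟩, 0, ?_, ?_⟩, ?_⟩
          · exact Metric.mem_closedBall_self (by positivity)
          · exact add_zero _
          · change ((1 : ℝ) / 2) ^ n • (2 : ℝ) ^ n • w = w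
            rw [smul_smul, ← mul_pow]
            norm_num
        calc (N n).toSeminorm w ^ 2 ≤ ((1 / 2) ^ n) ^ 2 :=
              pow_le_pow_left₀ (apply_nonneg _ _) h2 2
          _ = (1 / 4 : ℝ) ^ n := by rw [← pow_mul, mul_comm, pow_mul]; norm_num
      calc ∑ n ∈ s, (N n).toSeminorm w ^ 2 ≤ ∑ n ∈ s, (1 / 4 : ℝ) ^ n :=
            Finset.sum_le_sum fun n _ => h1 n
        _ ≤ ∑' n, (1 / 4 : ℝ) ^ n :=
            (summable_geometric_of_lt_one (by norm_num) (by norm_num)).sum_le_tsum s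
              fun n _ => by positivity
        _ = (1 - 1 / 4)⁻¹ := tsum_geometric_of_lt_one (by norm_num) (by norm_num)
        _ ≤ 2 ^ 2 := by norm_num
    exact ⟨v, hv⟩

end Renorming

section Flow

open scoped Pointwise

variable {S : Type v} {X : Type u} [Semigroup S] [TopologicalSpace X] [SemigroupAction S X]

/-- Passing to an equivariantly embedded subflow. -/
theorem IsEberleinFlow.of_isEmbedding [TopologicalSpace S] {Z : Type u} [TopologicalSpace Z]
    [SemigroupAction S Z] (hX : IsEberleinFlow S X) (β : Z → X) (hβ : IsEmbedding β)
    (hs : ∀ (s : S) (z : Z), β (s • z) = s • β z) : IsEberleinFlow S Z := by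
  obtain ⟨V, _, _, _, hV, ρ, hρ⟩ := hX
  exact ⟨V, inferInstance, inferInstance, inferInstance, hV,
    { h := ρ.h
      norm_le_one := ρ.norm_le_one
      antihom := ρ.antihom
      weakly_continuous := ρ.weakly_continuous
      α := ρ.α ∘ β
      continuous_α := ρ.continuous_α.comp hβ.continuous
      equivariant := fun s z v => by
        rw [Function.comp_apply, hs, ρ.equivariant, Function.comp_apply] }, hρ.comp hβ⟩

/-- The dual ball of a reflexive space is embedded in the dual with its weak topology. -/
theorem IsReflexiveSpace.isEmbedding_toWeakSpace {V : Type u} [NormedAddCommGroup V]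
    [NormedSpace ℝ V] (hV : IsReflexiveSpace V) :
    IsEmbedding fun φ : DualBall V => toWeakSpace ℝ (StrongDual ℝ V) (WeakDual.toStrongDual φ.1) := by
  refine (Continuous.isClosedEmbedding (continuous_toWeakSpace fun Φ => ?_) ?_).isEmbedding
  · obtain ⟨v, rfl⟩ := hV Φ
    exact (WeakDual.eval_continuous v).comp continuous_subtype_val
  · exact (toWeakSpace ℝ (StrongDual ℝ V)).injective.comp
      (WeakDual.toStrongDual.injective.comp Subtype.val_injective)

theorem IsEberleinFlow.embedsInWeakBanach [TopologicalSpace S] (hX : IsEberleinFlow S X) :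
    EmbedsInWeakBanach S X := by
  obtain ⟨V, _, _, _, hV, ρ, hρ⟩ := hX
  refine ⟨StrongDual ℝ V, inferInstance, inferInstance, inferInstance,
    fun s => (ContinuousLinearMap.compL ℝ V V ℝ).flip (ρ.h s),
    fun x => WeakDual.toStrongDual (ρ.α x).1, fun s => ?_, fun s t => ?_, fun s x => ?_,
    hV.isEmbedding_toWeakSpace.comp hρ⟩
  · refine ContinuousLinearMap.opNorm_le_bound _ zero_le_one fun φ => ?_
    rw [one_mul]
    exact (φ.opNorm_comp_le _).trans (mul_le_of_le_one_right (norm_nonneg _) (ρ.norm_le_one s))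
  · ext φ v
    simp [ρ.antihom]
  · ext v
    exact ρ.equivariant s x v

theorem EmbedsInWeakBanach.hasRightStrictDuality [CompactSpace X]
    (hu : ActsUnitally S X) (hX : EmbedsInWeakBanach S X) : HasRightStrictDuality S X := by
  obtain ⟨V, _, _, _, h, α, h1, hmul, heq, hα⟩ := hX
  let T : Set (DualBall V) :=
    {φ | ∀ e : S, (∀ s : S, e * s = s ∧ s * e = s) → ∀ v, φ.1 (h e v) = φ.1 v}
  have hev : ∀ v, Continuous fun φ : DualBall V => φ.1 v := fun v =>
    (WeakDual.eval_continuous v).comp continuous_subtype_val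
  have hT : IsClosed T := by
    simp only [T, ofPred_forall]
    exact isClosed_iInter fun e => isClosed_iInter fun _ => isClosed_iInter fun v =>
      isClosed_eq (hev _) (hev _)
  have : CompactSpace T := isCompact_iff_compactSpace.1 hT.isCompact
  let act : S → DualBall V → DualBall V := fun s φ =>
    ⟨StrongDual.toWeakDual ((WeakDual.toStrongDual φ.1).comp (h s)),
      (ContinuousLinearMap.opNorm_comp_le _ _).trans (mul_le_one₀ φ.2 (norm_nonneg _) (h1 s))⟩
  have hact : ∀ s φ v, (act s φ).1 v = φ.1 (h s v) := fun _ _ _ => rfl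
  have hactT : ∀ s, ∀ φ ∈ T, act s φ ∈ T := fun s φ _ e he v => by
    rw [hact, hact, ← ContinuousLinearMap.comp_apply, ← hmul, (he s).2]
  let I : SemigroupAction Sᵐᵒᵖ T :=
    { smul := fun s φ => ⟨act s.unop φ.1, hactT _ _ φ.2⟩
      mul_smul := fun s t φ => Subtype.ext (Subtype.ext (DFunLike.ext _ _ fun v => by
        change φ.1.1 (h (t.unop * s.unop) v) = φ.1.1 (h t.unop (h s.unop v))
        rw [hmul, ContinuousLinearMap.comp_apply])) }
  have hsmul : ∀ (s : S) (φ : T) (v : V), (MulOpposite.op s • φ).1.1 v = φ.1.1 (h s v) :=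
    fun _ _ _ => rfl
  have hcont : ∀ φ : StrongDual ℝ V, Continuous fun x => φ (α x) := fun φ =>
    (continuous_functional_weakSpace φ).comp hα.continuous
  refine ⟨T, inferInstance, inferInstance, inferInstance, I, fun (φ : T) (x : X) => φ.1.1 (α x), ?_,
    ⟨fun x => (hev _).comp continuous_subtype_val, fun φ : T => hcont (WeakDual.toStrongDual φ.1.1),
      fun φ s x => by rw [hsmul, heq], ?_⟩⟩
  · intro e he φ
    refine Subtype.ext (Subtype.ext (DFunLike.ext _ _ fun v => ?_))
    exact φ.2 e.unop (fun s => ⟨congrArg MulOpposite.unop (he (MulOpposite.op s)).2,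
      congrArg MulOpposite.unop (he (MulOpposite.op s)).1⟩) v
  · refine (Continuous.isClosedEmbedding
      (continuous_pi fun φ : T => hcont (WeakDual.toStrongDual φ.1.1)) fun x y hxy => ?_).isEmbedding
    have hball : ∀ φ : DualBall V, φ.1 (α x) = φ.1 (α y) := by
      intro φ
      by_cases hid : ∃ e : S, ∀ s : S, e * s = s ∧ s * e = s
      · obtain ⟨e, he⟩ := hid
        have hmem : act e φ ∈ T := fun e' he' v => by
          rw [hact, hact, ← ContinuousLinearMap.comp_apply, ← hmul, (he' e).2]
        have := congrFun hxy ⟨act e φ, hmem⟩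
        change φ.1 (h e (α x)) = φ.1 (h e (α y)) at this
        rwa [← heq, ← heq, hu e he, hu e he] at this
      · exact congrFun hxy ⟨φ, fun e he => absurd ⟨e, he⟩ hid⟩
    refine hα.injective (congrArg _ (eq_of_sub_eq_zero ?_))
    obtain ⟨g, hg, hgx⟩ := exists_dual_vector'' ℝ (α x - α y)
    have := hball ⟨StrongDual.toWeakDual g, hg⟩
    change g (α x) = g (α y) at this
    rw [map_sub, this, sub_self] at hgx
    exact norm_eq_zero.1 (by simpa using hgx.symm)

section Invariant

variable [ContinuousConstSMul S X]

theorem IsInvariantSet.insert_zero_iUnion {K : ℕ → Set C(X, ℝ)} (hK : ∀ n, IsInvariantSet S (K n)) :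
    IsInvariantSet S (insert 0 (⋃ n, ((1 / 2 : ℝ) ^ n) • K n)) := by
  rintro f (rfl | hf) s
  · exact mem_insert _ _
  · obtain ⟨n, g, hg, rfl⟩ := mem_iUnion.1 hf
    exact mem_insert_of_mem _ (mem_iUnion_of_mem n ⟨_, hK n g hg s, rfl⟩)

theorem IsInvariantSet.mul {K L : Set C(X, ℝ)} (hK : IsInvariantSet S K)
    (hL : IsInvariantSet S L) : IsInvariantSet S (K * L) := by
  rintro _ ⟨f, hf, g, hg, rfl⟩ s
  exact ⟨_, hK f hf s, _, hL g hg s, rfl⟩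

theorem IsInvariantSet.comp {K : Set C(X, ℝ)} (hK : IsInvariantSet S K) (g : C(ℝ, ℝ)) :
    IsInvariantSet S ((fun f => g.comp f) '' K) := by
  rintro _ ⟨f, hf, rfl⟩ s
  exact ⟨_, hK f hf s, rfl⟩

end Invariant

/-- A bounded homeomorphic copy of the real line. -/
noncomputable def halfArctan : C(ℝ, ℝ) := ⟨fun t => Real.arctan t / 2, by fun_prop⟩

theorem abs_halfArctan_le (t : ℝ) : |halfArctan t| ≤ 1 := by
  have h1 := Real.arctan_lt_pi_div_two t
  have h2 := Real.neg_pi_div_two_lt_arctan t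
  have h3 := Real.pi_le_four
  change |Real.arctan t / 2| ≤ 1
  rw [abs_le]
  constructor <;> linarith

theorem halfArctan_injective : Function.Injective halfArctan := fun s t h =>
  Real.arctan_injective (by
    have h' : Real.arctan s / 2 = Real.arctan t / 2 := h
    linarith)

variable [CompactSpace X] [T2Space X]

theorem HasRightStrictDuality.exists_invariant_weaklyCompact [ContinuousConstSMul S X]
    (hX : HasRightStrictDuality S X) :
    ∃ K : ℕ → Set C(X, ℝ), (∀ n, IsInvariantSet S (K n) ∧ IsWeaklyCompact (K n)) ∧
      ∀ x y : X, x ≠ y → ∃ n, ∃ f ∈ K n, f x ≠ f y := by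
  obtain ⟨Y, _, _, _, _, p, -, hp⟩ := hX
  let F : Y → C(X, ℝ) := fun y => halfArctan.comp ⟨fun x => p y x, hp.continuous_right y⟩
  refine ⟨fun _ => range F, fun _ => ⟨?_, isWeaklyCompact_range (C := 1) (fun x => ?_) fun y => ?_⟩,
    fun x x' hne => ⟨0, ?_⟩⟩
  · rintro _ ⟨y, rfl⟩ s
    refine ⟨MulOpposite.op s • y, ContinuousMap.ext fun x => ?_⟩
    exact congrArg halfArctan (hp.invariant y s x)
  · exact halfArctan.continuous.comp (hp.continuous_left x)
  · exact (ContinuousMap.norm_le _ zero_le_one).2 fun x => abs_halfArctan_le _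
  · by_contra! hcon
    refine hne (hp.right_strict.injective (funext fun y => halfArctan_injective ?_))
    exact hcon _ ⟨y, rfl⟩

theorem exists_total_weaklyCompact [ContinuousConstSMul S X] {K : ℕ → Set C(X, ℝ)}
    (hK : ∀ n, IsInvariantSet S (K n) ∧ IsWeaklyCompact (K n))
    (hsep : ∀ x y : X, x ≠ y → ∃ n, ∃ f ∈ K n, f x ≠ f y) :
    ∃ M : Set C(X, ℝ), IsInvariantSet S M ∧ IsWeaklyCompact M ∧
      closure (Submodule.span ℝ M : Set C(X, ℝ)) = Set.univ := by
  let L : ℕ → Set C(X, ℝ) := fun n => (fun f => halfArctan.comp f) '' K n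
  have hLb : ∀ n, ∀ f ∈ L n, ‖f‖ ≤ 1 := by
    rintro n _ ⟨f, -, rfl⟩
    exact (ContinuousMap.norm_le _ zero_le_one).2 fun x => abs_halfArctan_le _
  have hscale : ∀ (n : ℕ) (f : C(X, ℝ)), ‖f‖ ≤ 1 → ‖((1 / 2 : ℝ) ^ n) • f‖ ≤ 1 := fun n f hf => by
    rw [norm_smul, Real.norm_of_nonneg (by positivity)]
    exact mul_le_one₀ (pow_le_one₀ (by norm_num) (by norm_num)) (norm_nonneg _) hf
  have hbdd : ∀ {Q : ℕ → Set C(X, ℝ)}, (∀ n, ∀ f ∈ Q n, ‖f‖ ≤ 1) →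
      ∀ f ∈ insert 0 (⋃ n, ((1 / 2 : ℝ) ^ n) • Q n), ‖f‖ ≤ 1 := by
    rintro Q hQ f (rfl | hf)
    · simp
    · obtain ⟨n, g, hg, rfl⟩ := mem_iUnion.1 hf
      exact hscale n g (hQ n g hg)
  let A : Set C(X, ℝ) := insert 0 (⋃ n, ((1 / 2 : ℝ) ^ n) • L n)
  have hApc : IsPointwiseCompact A :=
    .insert_zero_iUnion (fun n => (hK n).2.isPointwiseCompact.comp _) hLb
  have hAinv : IsInvariantSet S A := .insert_zero_iUnion fun n => (hK n).1.comp _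
  let B : Set C(X, ℝ) := insert 1 A
  have hone : ‖(1 : C(X, ℝ))‖ ≤ 1 := (ContinuousMap.norm_le _ zero_le_one).2 fun x => by simp
  have hBpc : IsPointwiseCompact B := by
    rw [IsPointwiseCompact, image_insert_eq]
    exact IsCompact.insert hApc _
  have hBinv : IsInvariantSet S B := by
    rintro f (rfl | hf) s
    · exact mem_insert _ _
    · exact mem_insert_of_mem _ (hAinv f hf s)
  have hBb : ∀ f ∈ B, ‖f‖ ≤ 1 := by
    rintro f (rfl | hf)
    · exact hone
    · exact hbdd hLb f hf
  have hpow : ∀ m : ℕ, IsPointwiseCompact (B ^ m) ∧ IsInvariantSet S (B ^ m) ∧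
      ∀ f ∈ B ^ m, ‖f‖ ≤ 1 := by
    intro m
    induction m with
    | zero =>
      rw [pow_zero]
      refine ⟨?_, ?_, ?_⟩
      · rw [IsPointwiseCompact, ← singleton_one, image_singleton]
        exact isCompact_singleton
      · rintro _ rfl s
        exact mem_one.2 rfl
      · rintro _ rfl
        exact hone
    | succ m ih =>
      rw [pow_succ]
      refine ⟨ih.1.mul hBpc, ih.2.1.mul hBinv, ?_⟩
      rintro _ ⟨f, hf, g, hg, rfl⟩
      exact (norm_mul_le f g).trans (mul_le_one₀ (ih.2.2 f hf) (norm_nonneg _) (hBb g hg))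
  let M : Set C(X, ℝ) := insert 0 (⋃ m, ((1 / 2 : ℝ) ^ m) • B ^ m)
  have hMpc : IsPointwiseCompact M :=
    .insert_zero_iUnion (fun m => (hpow m).1) fun m => (hpow m).2.2
  refine ⟨M, .insert_zero_iUnion fun m => (hpow m).2.1,
    hMpc.isWeaklyCompact (hbdd fun m => (hpow m).2.2), ?_⟩
  have hBM : ∀ m, ∀ f ∈ B ^ m, f ∈ Submodule.span ℝ M := fun m f hf => by
    have h1 : ((1 / 2 : ℝ) ^ m) • f ∈ M :=
      mem_insert_of_mem _ (mem_iUnion_of_mem m ⟨f, hf, rfl⟩)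
    have h2 := Submodule.smul_mem _ ((2 : ℝ) ^ m) (Submodule.subset_span (R := ℝ) h1)
    rwa [smul_smul, ← mul_pow, show (2 : ℝ) * (1 / 2) = 1 by norm_num, one_pow, one_smul] at h2
  have hmonoid : ∀ f ∈ Submonoid.closure B, ∃ m, f ∈ B ^ m := fun f hf => by
    induction hf using Submonoid.closure_induction with
    | mem f hf => exact ⟨1, by rwa [pow_one]⟩
    | one => exact ⟨0, by rw [pow_zero]; exact mem_one.2 rfl⟩
    | mul f g _ _ hf hg =>
      obtain ⟨m, hm⟩ := hf
      obtain ⟨n, hn⟩ := hg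
      exact ⟨m + n, by rw [pow_add]; exact mul_mem_mul hm hn⟩
  have hadj : (Algebra.adjoin ℝ B : Set C(X, ℝ)) ⊆ Submodule.span ℝ M := by
    have : Subalgebra.toSubmodule (Algebra.adjoin ℝ B) ≤ Submodule.span ℝ M := by
      rw [Algebra.adjoin_eq_span]
      refine Submodule.span_le.2 fun f hf => ?_
      obtain ⟨m, hm⟩ := hmonoid f hf
      exact hBM m f hm
    exact this
  have hSW := ContinuousMap.subalgebra_topologicalClosure_eq_top_of_separatesPoints
    (Algebra.adjoin ℝ B) (fun x y hxy => by
      obtain ⟨n, f, hf, hfxy⟩ := hsep x y hxy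
      refine ⟨_, ⟨((1 / 2 : ℝ) ^ n) • halfArctan.comp f, Algebra.subset_adjoin
        (mem_insert_of_mem _ (mem_insert_of_mem _ (mem_iUnion_of_mem n ⟨_, ⟨f, hf, rfl⟩, rfl⟩))),
        rfl⟩, fun heq => hfxy (halfArctan_injective ?_)⟩
      exact mul_left_cancel₀ (pow_ne_zero n (by norm_num : (1 / 2 : ℝ) ≠ 0)) heq)
  refine eq_univ_of_univ_subset ?_
  calc (univ : Set C(X, ℝ)) = ((Algebra.adjoin ℝ B).topologicalClosure : Set C(X, ℝ)) := by
        rw [hSW]; rfl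
    _ = closure (Algebra.adjoin ℝ B : Set C(X, ℝ)) := Subalgebra.topologicalClosure_coe _
    _ ⊆ _ := closure_mono hadj

theorem isEberleinFlow_dualBall [TopologicalSpace S] [SemitopologicalFlow S X]
    {M : Set C(X, ℝ)} (hinv : IsInvariantSet S M) (hM : IsWeaklyCompact M)
    (hdense : closure (Submodule.span ℝ M : Set C(X, ℝ)) = Set.univ) :
    IsEberleinFlow S (DualBall C(X, ℝ)) := by
  let M' : Set C(X, ℝ) := insert 0 M
  have hM' : IsWeaklyCompact M' := by
    rw [IsWeaklyCompact, image_insert_eq]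
    exact IsCompact.insert hM _
  have hinv' : ∀ s : S, MapsTo (translateCLM (X := X) s) M' M' := by
    rintro s f (rfl | hf)
    · exact mem_insert _ _
    · exact mem_insert_of_mem _ (hinv f hf s)
  have hsub : M' ⊆ closedAbsConvexHull ℝ M' := subset_closedAbsConvexHull
  obtain ⟨V, _, _, _, j, hV, hj, hWj, hlift⟩ := exists_reflexive_factorization
    hM'.closedAbsConvexHull absConvex_convexClosedHull (hsub (mem_insert _ _))
  have hmaps : ∀ s : S, MapsTo (translateCLM (X := X) s) (closedAbsConvexHull ℝ M')
      (closedAbsConvexHull ℝ M') := fun s => by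
    refine closedAbsConvexHull_min (t := translateCLM (X := X) s ⁻¹' closedAbsConvexHull ℝ M')
      (fun f hf => hsub (hinv' s hf)) ⟨?_, ?_⟩
      (isClosed_closedAbsConvexHull.preimage (translateCLM (X := X) s).continuous)
    · rintro a ha _ ⟨f, hf, rfl⟩
      change translateCLM s (a • f) ∈ closedAbsConvexHull ℝ M'
      rw [map_smul]
      exact absConvex_convexClosedHull.1 a ha ⟨_, hf, rfl⟩
    · exact absConvex_convexClosedHull.2.linear_preimage (translateCLM (X := X) s).toLinearMap
  choose h h1 hh using fun s : S => hlift (translateCLM s) (norm_translateCLM_le s) (hmaps s)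
  have hhx : ∀ s v x, j (h s v) x = j v (s • x) := fun s v x => by rw [hh]; rfl
  have hc : 0 < ‖j‖ + 1 := by positivity
  let α : DualBall C(X, ℝ) → DualBall V := fun φ =>
    ⟨StrongDual.toWeakDual ((‖j‖ + 1)⁻¹ • (WeakDual.toStrongDual φ.1).comp j), by
      refine ContinuousLinearMap.opNorm_le_bound _ zero_le_one fun v => ?_
      change ‖(‖j‖ + 1)⁻¹ * WeakDual.toStrongDual φ.1 (j v)‖ ≤ _
      rw [norm_mul, norm_inv, Real.norm_of_nonneg hc.le, one_mul, inv_mul_le_iff₀ hc]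
      calc ‖WeakDual.toStrongDual φ.1 (j v)‖ ≤ 1 * ‖j v‖ :=
            (WeakDual.toStrongDual φ.1).le_of_opNorm_le φ.2 _
        _ ≤ ‖j‖ * ‖v‖ := by rw [one_mul]; exact j.le_opNorm v
        _ ≤ (‖j‖ + 1) * ‖v‖ := by gcongr; linarith⟩
  have hα : ∀ φ v, (α φ).1 v = (‖j‖ + 1)⁻¹ * φ.1 (j v) := fun _ _ => rfl
  have hαc : Continuous α := by
    refine Continuous.subtype_mk (WeakDual.continuous_of_continuous_eval fun v => ?_) _
    exact continuous_const.mul ((WeakDual.eval_continuous (j v)).comp continuous_subtype_val)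
  refine ⟨V, inferInstance, inferInstance, inferInstance, hV,
    { h := h
      norm_le_one := h1
      antihom := fun s t => ContinuousLinearMap.ext fun v => hj (ContinuousMap.ext fun x => by
        rw [ContinuousLinearMap.comp_apply, hhx, hhx, hhx, mul_smul])
      weakly_continuous := ContinuousLinearMapWOT.continuous_of_dual_apply_continuous fun v φ =>
        hV.continuous_functional (g := fun s => h s v) (C := ‖v‖)
          (fun s => ((h s).le_of_opNorm_le (h1 s) v).trans (one_mul _).le)
          (fun x : X => (ContinuousMap.evalCLM ℝ x).comp j)
          (fun v w hvw => hj (ContinuousMap.ext hvw))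
          (fun x => by
            change Continuous fun s => j (h s v) x
            simp only [hhx]
            exact (j v).continuous.comp (SemitopologicalFlow.continuous_orbit x)) φ
      α := α
      continuous_α := hαc
      equivariant := fun s φ v => by
        rw [hα, hα, DualBall.smul_apply, hh]
        rfl }, ?_⟩
  refine (Continuous.isClosedEmbedding hαc fun φ ψ hφψ => ?_).isEmbedding
  have hrange : ∀ v, φ.1 (j v) = ψ.1 (j v) := fun v => by
    have : (α φ).1 v = (α ψ).1 v := by rw [hφψ]
    rw [hα, hα] at this
    exact mul_left_cancel₀ (inv_ne_zero hc.ne') this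
  have hspan : (Submodule.span ℝ M : Set C(X, ℝ)) ⊆ range j := by
    have : Submodule.span ℝ M ≤ j.toLinearMap.range := Submodule.span_le.2 fun f hf =>
      hWj (hsub (mem_insert_of_mem _ hf))
    exact this
  have hd : Dense (Submodule.span ℝ M : Set C(X, ℝ)) := dense_iff_closure_eq.2 hdense
  refine Subtype.ext (DFunLike.coe_injective (Continuous.ext_on hd
    (WeakDual.toStrongDual φ.1).continuous (WeakDual.toStrongDual ψ.1).continuous fun f hf => ?_))
  obtain ⟨v, rfl⟩ := hspan hf
  exact hrange v

section Measures

/-- Integration against a probability measure as a functional on `C(Z)`. -/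
noncomputable def integralFunctional {Z : Type*} [TopologicalSpace Z] [CompactSpace Z]
    [MeasurableSpace Z] [BorelSpace Z] (μ : ProbabilityMeasure Z) : StrongDual ℝ C(Z, ℝ) :=
  LinearMap.mkContinuous
    { toFun := fun f : C(Z, ℝ) => ∫ x, f x ∂(μ : Measure Z)
      map_add' := fun f g => integral_add (f.continuous.integrable_of_hasCompactSupport
        (HasCompactSupport.of_compactSpace _)) (g.continuous.integrable_of_hasCompactSupport
        (HasCompactSupport.of_compactSpace _))
      map_smul' := fun a f => integral_const_mul a _ } 1 (fun f =>
        (norm_integral_le_of_norm_le_const (.of_forall fun x => f.norm_coe_le_norm x)).trans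
          (by simp))

theorem norm_integralFunctional_le {Z : Type*} [TopologicalSpace Z] [CompactSpace Z]
    [MeasurableSpace Z] [BorelSpace Z] (μ : ProbabilityMeasure Z) : ‖integralFunctional μ‖ ≤ 1 :=
  LinearMap.mkContinuous_norm_le _ zero_le_one _

variable [MeasurableSpace X] [BorelSpace X]

/-- Regular probability measures as functionals on `C(Z)`. -/
noncomputable def RegularProbability.toDualBall {Z : Type u} [TopologicalSpace Z]
    [CompactSpace Z] [MeasurableSpace Z] [BorelSpace Z]
    (μ : RegularProbability Z) : DualBall C(Z, ℝ) :=
  ⟨StrongDual.toWeakDual (integralFunctional μ.1), norm_integralFunctional_le μ.1⟩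

theorem RegularProbability.toDualBall_apply {Z : Type u} [TopologicalSpace Z]
    [CompactSpace Z] [MeasurableSpace Z] [BorelSpace Z]
    (μ : RegularProbability Z) (f : C(Z, ℝ)) :
    μ.toDualBall.1 f = ∫ x, f x ∂(μ.1 : Measure Z) := rfl

theorem RegularProbability.isEmbedding_toDualBall :
    IsEmbedding (RegularProbability.toDualBall (Z := X)) := by
  have hc : Continuous (RegularProbability.toDualBall (Z := X)) := by
    refine Continuous.subtype_mk (WeakDual.continuous_of_continuous_eval fun f => ?_) _
    refine continuous_iff_continuousAt.2 fun μ => ?_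
    exact ProbabilityMeasure.tendsto_iff_forall_integral_tendsto.1
      (continuous_subtype_val.tendsto μ) (BoundedContinuousFunction.mkOfCompact f)
  refine ⟨isInducing_iff_nhds.2 fun μ => le_antisymm (hc.tendsto μ).le_comap ?_, fun μ ν h => ?_⟩
  · refine Filter.tendsto_id'.1 (tendsto_subtype_rng.2 ?_)
    refine ProbabilityMeasure.tendsto_iff_forall_integral_tendsto.2 fun f => ?_
    exact (((WeakDual.eval_continuous f.toContinuousMap).comp continuous_subtype_val).tendsto
      μ.toDualBall).comp Filter.tendsto_comap
  · have : (μ.1 : Measure X).Regular := μ.2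
    have : (ν.1 : Measure X).Regular := ν.2
    exact Subtype.ext (ProbabilityMeasure.toMeasure_injective
      (Measure.ext_of_integral_eq_on_compactlySupported fun f =>
        congrArg (fun φ : DualBall C(X, ℝ) => φ.1 f.toContinuousMap) h))

theorem RegularProbability.toDualBall_smul [ContinuousConstSMul S X] (s : S)
    (μ : RegularProbability X) : (s • μ).toDualBall = s • μ.toDualBall := by
  refine Subtype.ext (DFunLike.ext _ _ fun f => ?_)
  rw [DualBall.smul_apply, toDualBall_apply, toDualBall_apply, coe_smul,
    integral_map (continuous_const_smul s).aemeasurable f.continuous.aestronglyMeasurable]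
  rfl

theorem regular_dirac {Z : Type*} [TopologicalSpace Z] [T2Space Z] [MeasurableSpace Z]
    [BorelSpace Z] (x : Z) : (Measure.dirac x).Regular := by
  have : (Measure.dirac x).InnerRegular := ⟨fun U hU r hr => by
    rw [Measure.dirac_apply' x hU] at hr
    by_cases hx : x ∈ U
    · refine ⟨{x}, singleton_subset_iff.2 hx, isCompact_singleton, ?_⟩
      rw [Measure.dirac_apply_of_mem (mem_singleton x)]
      simpa [hx] using hr
    · simp [hx] at hr⟩
  infer_instance

/-- Point masses. -/
noncomputable def diracRegularProbability (x : X) : RegularProbability X :=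
  ⟨diracProba x, regular_dirac x⟩

theorem isEmbedding_diracRegularProbability : IsEmbedding (diracRegularProbability (X := X)) :=
  IsEmbedding.of_comp (Continuous.subtype_mk continuous_diracProba _) continuous_subtype_val
    isEmbedding_diracProba

theorem diracRegularProbability_smul [ContinuousConstSMul S X] (s : S) (x : X) :
    diracRegularProbability (s • x) = s • diracRegularProbability x :=
  Subtype.ext (Subtype.ext (Measure.map_dirac' (continuous_const_smul s).measurable x).symm)

end Measures

end Flow

theorem theorem4p9 (S : Type v) (X : Type u)
    [Semigroup S] [TopologicalSpace S] [SeparatelyContinuousMul S]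
    [TopologicalSpace X] [CompactSpace X] [T2Space X] [MeasurableSpace X] [BorelSpace X]
    [SemigroupAction S X] [SemitopologicalFlow S X] :
    List.TFAE [
      IsEberleinFlow S X,
      EmbedsInWeakBanach S X,
      HasRightStrictDuality S X,
      ∃ K : ℕ → Set C(X, ℝ),
        (∀ n, IsInvariantSet S (K n) ∧ IsWeaklyCompact (K n)) ∧
        ∀ x y : X, x ≠ y → ∃ n, ∃ f ∈ K n, f x ≠ f y,
      ∃ M : Set C(X, ℝ), IsInvariantSet S M ∧ IsWeaklyCompact M ∧
        closure (Submodule.span ℝ M : Set C(X, ℝ)) = Set.univ,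
      IsEberleinFlow S (DualBall C(X, ℝ)),
      IsEberleinFlow S (RegularProbability X)] := by
  tfae_have 1 → 2 := IsEberleinFlow.embedsInWeakBanach
  tfae_have 2 → 3 := EmbedsInWeakBanach.hasRightStrictDuality SemitopologicalFlow.acts_unitally
  tfae_have 3 → 4 := HasRightStrictDuality.exists_invariant_weaklyCompact
  tfae_have 4 → 5 := fun ⟨_, hK, hsep⟩ => exists_total_weaklyCompact hK hsep
  tfae_have 5 → 6 := fun ⟨_, hinv, hM, hdense⟩ => isEberleinFlow_dualBall hinv hM hdense
  tfae_have 6 → 7 := fun h => h.of_isEmbedding _ RegularProbability.isEmbedding_toDualBall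
    RegularProbability.toDualBall_smul
  tfae_have 7 → 1 := fun h => h.of_isEmbedding _ isEmbedding_diracRegularProbability
    diracRegularProbability_smul
  tfae_finish
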